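/- For $d\in\mathbb R$ consider, on the phase space $M=\{(q_1,q_2,p_1,p_2)\in\mathbb R^4: q_1>0,\ q_2>0\}$ with the canonical Poisson bracket, the Hamiltonian system given by $$H_1=2p_1p_2+q_1^{-d-2}q_2^{d},\qquad\text{and let}\qquad I_2=(p_1q_1-p_2q_2)^2-2\,\frac{q_2^{d+1}}{q_1^{d+1}} .$$ First integrals are allowed to be complex-valued; a first integral on an open set $U\subseteq M$ is a $C^\infty$ function $F:U\to\mathbb C$ with $\{F,H_1\}=0$ on $U$. Functions are called functionally independent on $U$ if their differentials are linearly independent over $\mathbb C$ on a dense subset of $U$. A function $F$ is called algebraic on $U$ if $P(q_1,q_2,p_1,p_2,F)=0$ on $U$ for some non-zero polynomial $P$ with complex coefficients. Put $$H_3=q_2^{-(d+1)}\bigl(p_2q_2-p_1q_1+\sqrt{I_2}\bigr)\bigl(p_1q_1+p_2q_2+\sqrt{I_2}\bigr)^{d+1},$$ $$H_4=q_2^{-(d+1)}\bigl(p_2q_2-p_1q_1-\sqrt{I_2}\bigr)\bigl(p_1q_1+p_2q_2-\sqrt{I_2}\bigr)^{d+1},$$ with principal values of the root and of the power, on the sets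 $\Omega_{+}$, respectively $\Omega_{-}$, of the points of $M$ at which $I_2\neq0$ and $p_1q_1+p_2q_2\pm\sqrt{I_2}\neq0$. Theorem. (1) For every $d\in\mathbb R$ the system is integrable in the Liouville sense on $M$ with the integral $I_2$, quadratic in the momenta: $H_1$ and $I_2$ are smooth, $\{H_1,I_2\}=0$, and $H_1,I_2$ are functionally independent on $M$. (2) For every $d\in\mathbb R$ the sets $\Omega_\pm$ are open and dense in $M$, $H_3$ is a first integral on $\Omega_+$ and $H_4$ is a first integral on $\Omega_-$. On any non-empty open subset of $\Omega_+$ (respectively $\Omega_-$), the function $H_3$ (respectively $H_4$) is algebraic if and only if $d$ is rational. (3) Let $d\neq-1$. Then $H_1,I_2,H_3$ are functionally independent on $\Omega_+$ and $H_1,I_2,H_4$ are functionally independent on $\Omega_-$. The system is super-integrable with an algebraic additional first integral, that is, on some open dense subset of $M$ there is an algebraic first integral functionally independent of $H_1$ and $I_2$, if and only if $d$ is a rational number. Moreover, if $d$ is irrational, there is no algebraic first integral functionally independent of $H_1$ and $I_2$ on any non-empty open subset of $M$. -/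

import Mathlib

open scoped ContDiff

noncomputable section

/-- The phase space `ℝ^{2n}`; a point `z` has positions `z.1 i` and momenta `z.2 i`. -/
abbrev Phase (n : ℕ) : Type := (Fin n → ℝ) × (Fin n → ℝ)

/-- The partial derivative `∂F/∂q_i` of a complex-valued function on phase space. -/
def dq {n : ℕ} (i : Fin n) (F : Phase n → ℂ) (z : Phase n) : ℂ :=
  fderiv ℝ F z (Pi.single i 1, 0)

/-- The partial derivative `∂F/∂p_i` of a complex-valued function on phase space. -/
def dp {n : ℕ} (i : Fin n) (F : Phase n → ℂ) (z : Phase n) : ℂ :=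
  fderiv ℝ F z (0, Pi.single i 1)

/-- The canonical Poisson bracket `{F, G} = ∑ i, (∂F/∂q_i ∂G/∂p_i - ∂F/∂p_i ∂G/∂q_i)`. -/
def poissonBracket {n : ℕ} (F G : Phase n → ℂ) (z : Phase n) : ℂ :=
  ∑ i, (dq i F z * dp i G z - dp i F z * dq i G z)

/-- `F` is a smooth first integral, on the open set `U`, of the Hamiltonian system given by `H`. -/
def IsFirstIntegralOn {n : ℕ} (H F : Phase n → ℂ) (U : Set (Phase n)) : Prop :=
  ContDiffOn ℝ ∞ F U ∧ ∀ z ∈ U, poissonBracket F H z = 0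

/-- Functional independence on the open set `U`: the differentials are linearly independent over
`ℂ` at all points of a dense subset of `U`. -/
def FunctionallyIndependentOn {n k : ℕ} (F : Fin k → Phase n → ℂ) (U : Set (Phase n)) : Prop :=
  U ⊆ closure {z | z ∈ U ∧ LinearIndependent ℂ (fun j => fderiv ℝ (F j) z)}

/-- Integrability in the Liouville sense on the open set `U`: `n` smooth functions on the
`2n`-dimensional phase space, in involution and functionally independent. -/
def IsLiouvilleIntegrableOn {n : ℕ} (F : Fin n → Phase n → ℂ) (U : Set (Phase n)) : Prop :=
  (∀ j, ContDiffOn ℝ ∞ (F j) U) ∧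
  (∀ j k, ∀ z ∈ U, poissonBracket (F j) (F k) z = 0) ∧
  FunctionallyIndependentOn F U

/-- `F` is an algebraic function on `U`: it satisfies a non-trivial polynomial equation
`P(q, p, F(q, p)) = 0` whose coefficients are polynomials in the coordinates of phase space. -/
def IsAlgebraicFunctionOn {n : ℕ} (F : Phase n → ℂ) (U : Set (Phase n)) : Prop :=
  ∃ P : Polynomial (MvPolynomial (Fin n ⊕ Fin n) ℂ), P ≠ 0 ∧
    ∀ z ∈ U, (P.map (MvPolynomial.eval
      (Sum.elim (fun i => (z.1 i : ℂ)) (fun i => (z.2 i : ℂ))))).eval (F z) = 0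

/-- The part `q₁ > 0`, `q₂ > 0` of phase space, where all real powers of `q₁`, `q₂` make sense. -/
def posPhase : Set (Phase 2) := {z | 0 < z.1 0 ∧ 0 < z.1 1}

/-- The Hamiltonian `H₁ = 2 p₁ p₂ + q₁^{-d-2} q₂^d`. -/
def H1 (d : ℝ) (z : Phase 2) : ℂ :=
  ((2 * z.2 0 * z.2 1 + z.1 0 ^ (-d - 2) * z.1 1 ^ d : ℝ) : ℂ)

/-- The function `I₂ = (p₁ q₁ - p₂ q₂)² - 2 q₂^{d+1} / q₁^{d+1}`, as a complex-valued function. -/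
def I2 (d : ℝ) (z : Phase 2) : ℂ :=
  (((z.2 0 * z.1 0 - z.2 1 * z.1 1) ^ 2 - 2 * (z.1 1 ^ (d + 1) / z.1 0 ^ (d + 1)) : ℝ) : ℂ)

/-- The principal square root of `I₂` (purely imaginary where `I₂ < 0`). -/
def sqrtI2 (d : ℝ) (z : Phase 2) : ℂ := I2 d z ^ (1 / 2 : ℂ)

/-- The factor `p₁ q₁ + p₂ q₂ + ε √I₂`. -/
def powerBase (d ε : ℝ) (z : Phase 2) : ℂ :=
  ((z.2 0 * z.1 0 + z.2 1 * z.1 1 : ℝ) : ℂ) + (ε : ℂ) * sqrtI2 d z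

/-- `q₂^{-(d+1)} (p₂ q₂ - p₁ q₁ + ε √I₂) (p₁ q₁ + p₂ q₂ + ε √I₂)^{d+1}`, with principal powers. -/
def signedIntegral (d ε : ℝ) (z : Phase 2) : ℂ :=
  ((z.1 1 ^ (-(d + 1)) : ℝ) : ℂ)
    * (((z.2 1 * z.1 1 - z.2 0 * z.1 0 : ℝ) : ℂ) + (ε : ℂ) * sqrtI2 d z)
    * powerBase d ε z ^ ((d + 1 : ℝ) : ℂ)

/-- The first integral `H₃`, with the sign `+`. -/
def H3 (d : ℝ) : Phase 2 → ℂ := signedIntegral d 1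

/-- The first integral `H₄`, with the sign `-`. -/
def H4 (d : ℝ) : Phase 2 → ℂ := signedIntegral d (-1)

/-- The points with `q₁, q₂ > 0`, `I₂ ≠ 0` and `p₁ q₁ + p₂ q₂ + ε √I₂ ≠ 0`. -/
def signedDomain (d ε : ℝ) : Set (Phase 2) :=
  {z | z ∈ posPhase ∧ I2 d z ≠ 0 ∧ powerBase d ε z ≠ 0}

/-- The domain of `H₃`. -/
def domH3 (d : ℝ) : Set (Phase 2) := signedDomain d 1

/-- The domain of `H₄`. -/
def domH4 (d : ℝ) : Set (Phase 2) := signedDomain d (-1)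

/-- On the open set `U` the system `H₁` has an algebraic first integral which is additional, i.e.
functionally independent of `H₁` and `I₂`. -/
def HasAlgebraicAdditionalIntegralOn (d : ℝ) (U : Set (Phase 2)) : Prop :=
  ∃ F : Phase 2 → ℂ, IsFirstIntegralOn (H1 d) F U ∧
    FunctionallyIndependentOn ![H1 d, I2 d, F] U ∧ IsAlgebraicFunctionOn F U

/-- The system `H₁` is super-integrable with algebraic additional first integral: such an integral
exists on an open dense subset of the phase space `q₁, q₂ > 0`. -/
def IsAlgebraicallySuperIntegrable (d : ℝ) : Prop :=
  ∃ U : Set (Phase 2), IsOpen U ∧ U ⊆ posPhase ∧ posPhase ⊆ closure U ∧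
    HasAlgebraicAdditionalIntegralOn d U

end

/-! For rational d, the functions H₃ and H₄ are built from the coordinates by field operations and
roots, hence are algebraic. They are first integrals because I₂ is constant along the flow and,
after multiplication by conjugates, the logarithmic derivatives of the three factors cancel
(`isFirstIntegralOn_signedIntegral`).

The substance is the irrational case. Let X = p₂∂/∂q₁ + p₁∂/∂q₂ and Y = (d+2)q₂∂/∂p₁ - d q₁∂/∂p₂.
Then {F,H₁} = 2 XF + q₁^{-d-3}q₂^{d-1} YF (`poissonBracket_H1_eq_fields`). If F is algebraic, so are
XF and YF on a smaller open set (`IsAlgebraicFunctionOn.exists_fderiv`). Were YF non-zero somewhere,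
the monomial q₁^{-d-3}q₂^{d-1} = -2 XF/YF would be algebraic there, which the irrational exponent
forbids (`not_isAlgebraicFunctionOn_rpow_mul_rpow`). So XF = YF = 0, and iterated commutators of X
and Y kill F as well (`fderiv_apply_commutator_eq_zero`). Together these fields span the tangent
space wherever p₁p₂ ≠ 0, so dF = 0 there, and F cannot be independent of H₁ and I₂.

That H₃ and H₄ are not algebraic for irrational d is then a corollary, since they are additional
first integrals. -/

noncomputable section

/-! ### Algebraic functions: closure properties and derivatives -/

section Algebraic

open Filter Topology

variable {n : ℕ}

/-- The positions and momenta of a phase point, as complex coordinates. -/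
def coords (z : Phase n) : Fin n ⊕ Fin n → ℂ :=
  Sum.elim (fun i => (z.1 i : ℂ)) (fun i => (z.2 i : ℂ))

/-- Functions on `U`, as an algebra over the polynomials in the coordinates. -/
@[reducible]
def coordAlgebra (U : Set (Phase n)) :
    Algebra (MvPolynomial (Fin n ⊕ Fin n) ℂ) (U → ℂ) :=
  (RingHom.pi fun z : U => MvPolynomial.eval (coords z.1)).toAlgebra

attribute [local instance] coordAlgebra

/-- The value at `z` of `P(q, p, y)`. -/
def evalAt (P : Polynomial (MvPolynomial (Fin n ⊕ Fin n) ℂ)) (y : ℂ) (z : Phase n) : ℂ :=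
  (P.map (MvPolynomial.eval (coords z))).eval y

/-- This gives access to the general closure properties of algebraic elements. The ring of functions
on `U` may have zero divisors, but the ring of coefficients is a domain, which is enough. -/
theorem isAlgebraicFunctionOn_iff {F : Phase n → ℂ} {U : Set (Phase n)} :
    IsAlgebraicFunctionOn F U ↔
      IsAlgebraic (MvPolynomial (Fin n ⊕ Fin n) ℂ) (U.domRestrict F) := by
  refine exists_congr fun P => and_congr_right fun _ => ?_
  rw [funext_iff, Subtype.forall]
  refine forall₂_congr fun z hz => ?_
  have h := Polynomial.hom_eval₂ P
    (algebraMap (MvPolynomial (Fin n ⊕ Fin n) ℂ) (U → ℂ)) (Pi.evalRingHom (fun _ : U => ℂ) ⟨z, hz⟩)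
    (U.domRestrict F)
  rw [Polynomial.eval_map, Polynomial.aeval_def]
  exact (Eq.congr_left h).symm

theorem IsAlgebraicFunctionOn.congr {F G : Phase n → ℂ} {U : Set (Phase n)}
    (hF : IsAlgebraicFunctionOn F U) (h : Set.EqOn G F U) : IsAlgebraicFunctionOn G U := by
  obtain ⟨P, hP, h0⟩ := hF
  exact ⟨P, hP, fun z hz => by rw [h hz]; exact h0 z hz⟩

theorem IsAlgebraicFunctionOn.mono {F : Phase n → ℂ} {U V : Set (Phase n)}
    (hF : IsAlgebraicFunctionOn F U) (h : V ⊆ U) : IsAlgebraicFunctionOn F V := by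
  obtain ⟨P, hP, h0⟩ := hF
  exact ⟨P, hP, fun z hz => h0 z (h hz)⟩

theorem IsAlgebraicFunctionOn.add {F G : Phase n → ℂ} {U : Set (Phase n)}
    (hF : IsAlgebraicFunctionOn F U) (hG : IsAlgebraicFunctionOn G U) :
    IsAlgebraicFunctionOn (fun z => F z + G z) U := by
  rw [isAlgebraicFunctionOn_iff] at *
  exact IsAlgebraic.add hF hG

theorem IsAlgebraicFunctionOn.mul {F G : Phase n → ℂ} {U : Set (Phase n)}
    (hF : IsAlgebraicFunctionOn F U) (hG : IsAlgebraicFunctionOn G U) :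
    IsAlgebraicFunctionOn (fun z => F z * G z) U := by
  rw [isAlgebraicFunctionOn_iff] at *
  exact IsAlgebraic.mul hF hG

theorem IsAlgebraicFunctionOn.inv {F : Phase n → ℂ} {U : Set (Phase n)}
    (hF : IsAlgebraicFunctionOn F U) (h0 : ∀ z ∈ U, F z ≠ 0) :
    IsAlgebraicFunctionOn (fun z => (F z)⁻¹) U := by
  rw [isAlgebraicFunctionOn_iff] at *
  let : Invertible (U.domRestrict F) :=
    { invOf := U.domRestrict fun z => (F z)⁻¹
      invOf_mul_self := funext fun z => inv_mul_cancel₀ (h0 z z.2)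
      mul_invOf_self := funext fun z => mul_inv_cancel₀ (h0 z z.2) }
  exact IsAlgebraic.invOf hF

theorem IsAlgebraicFunctionOn.of_pow {F : Phase n → ℂ} {U : Set (Phase n)} {k : ℕ} (hk : 0 < k)
    (hF : IsAlgebraicFunctionOn (fun z => F z ^ k) U) : IsAlgebraicFunctionOn F U := by
  rw [isAlgebraicFunctionOn_iff] at *
  exact IsAlgebraic.of_pow hk hF

theorem isAlgebraicFunctionOn_eval (c : MvPolynomial (Fin n ⊕ Fin n) ℂ) (U : Set (Phase n)) :
    IsAlgebraicFunctionOn (fun z => MvPolynomial.eval (coords z) c) U := by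
  rw [isAlgebraicFunctionOn_iff]
  exact isAlgebraic_algebraMap (A := U → ℂ) c

theorem isAlgebraicFunctionOn_const (c : ℂ) (U : Set (Phase n)) :
    IsAlgebraicFunctionOn (fun _ => c) U :=
  (isAlgebraicFunctionOn_eval (MvPolynomial.C c) U).congr fun z _ => by simp

theorem isAlgebraicFunctionOn_position (i : Fin n) (U : Set (Phase n)) :
    IsAlgebraicFunctionOn (fun z => (z.1 i : ℂ)) U :=
  (isAlgebraicFunctionOn_eval (MvPolynomial.X (Sum.inl i)) U).congr fun z _ => by simp [coords]

theorem isAlgebraicFunctionOn_momentum (i : Fin n) (U : Set (Phase n)) :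
    IsAlgebraicFunctionOn (fun z => (z.2 i : ℂ)) U :=
  (isAlgebraicFunctionOn_eval (MvPolynomial.X (Sum.inr i)) U).congr fun z _ => by simp [coords]

theorem IsAlgebraicFunctionOn.zpow {F : Phase n → ℂ} {U : Set (Phase n)}
    (hF : IsAlgebraicFunctionOn F U) (h0 : ∀ z ∈ U, F z ≠ 0) (k : ℤ) :
    IsAlgebraicFunctionOn (fun z => F z ^ k) U := by
  have hpow : ∀ m : ℕ, IsAlgebraicFunctionOn (fun z => F z ^ m) U := by
    intro m
    induction m with
    | zero => simpa using isAlgebraicFunctionOn_const 1 U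
    | succ m ih => simpa only [pow_succ] using ih.mul hF
  cases k with
  | ofNat m => simpa using hpow m
  | negSucc m =>
    simpa only [zpow_negSucc] using (hpow (m + 1)).inv fun z hz => pow_ne_zero _ (h0 z hz)

theorem isAlgebraicFunctionOn_evalAt {F : Phase n → ℂ} {U : Set (Phase n)}
    (hF : IsAlgebraicFunctionOn F U) (P : Polynomial (MvPolynomial (Fin n ⊕ Fin n) ℂ)) :
    IsAlgebraicFunctionOn (fun z => evalAt P (F z) z) U := by
  induction P using Polynomial.induction_on' with
  | add P Q hP hQ => exact (hP.add hQ).congr fun z _ => by simp [evalAt]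
  | monomial k c =>
    have hpow : IsAlgebraicFunctionOn (fun z => F z ^ k) U := by
      rw [isAlgebraicFunctionOn_iff] at *
      exact IsAlgebraic.pow hF k
    exact ((isAlgebraicFunctionOn_eval c U).mul hpow).congr fun z _ => by simp [evalAt]

/-- A polynomial that vanishes on a non-empty open subset of phase space is zero. -/
theorem eq_zero_of_eval_coords_eq_zero {c : MvPolynomial (Fin n ⊕ Fin n) ℂ} {U : Set (Phase n)}
    (hU : IsOpen U) (hne : U.Nonempty)
    (h : ∀ z ∈ U, MvPolynomial.eval (coords z) c = 0) : c = 0 := by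
  obtain ⟨z, hz⟩ := hne
  obtain ⟨r, hr, hball⟩ := Metric.isOpen_iff.1 hU z hz
  let x : Fin n ⊕ Fin n → ℝ := Sum.elim z.1 z.2
  -- A box of real intervals around `z` is a product of infinite sets, which detects non-zero
  -- polynomials even over ℂ.
  refine MvPolynomial.funext_set (fun i => Complex.ofReal '' Metric.ball (x i) r) (fun i => ?_) ?_
  · refine Set.Infinite.image Complex.ofReal_injective.injOn ?_
    rw [Real.ball_eq_Ioo]
    exact Set.Ioo_infinite (by linarith)
  · intro y hy
    choose w hw hwy using fun i => hy i (Set.mem_univ i)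
    have hy' : y = coords ((fun i => w (Sum.inl i), fun i => w (Sum.inr i)) : Phase n) := by
      funext i
      rcases i with i | i <;> simp [coords, hwy]
    rw [hy', map_zero]
    refine h _ (hball ?_)
    rw [Metric.mem_ball, Prod.dist_eq, max_lt_iff, dist_pi_lt_iff hr, dist_pi_lt_iff hr]
    exact ⟨fun i => hw (Sum.inl i), fun i => hw (Sum.inr i)⟩

theorem continuous_coords : Continuous (coords : Phase n → Fin n ⊕ Fin n → ℂ) := by
  refine continuous_pi fun i => ?_
  rcases i with i | i <;> simp only [coords, Sum.elim_inl, Sum.elim_inr] <;> fun_prop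

theorem continuousOn_evalAt {F : Phase n → ℂ} {U : Set (Phase n)} (hF : ContinuousOn F U)
    (P : Polynomial (MvPolynomial (Fin n ⊕ Fin n) ℂ)) :
    ContinuousOn (fun z => evalAt P (F z) z) U := by
  induction P using Polynomial.induction_on' with
  | add P Q hP hQ => simpa [evalAt] using ContinuousOn.fun_add hP hQ
  | monomial k c =>
    simp only [evalAt, Polynomial.map_monomial, Polynomial.eval_monomial]
    exact ((MvPolynomial.continuous_eval c).comp continuous_coords).continuousOn.mul (hF.pow k)

/-- The directional derivatives of a polynomial in the coordinates are such polynomials. -/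
theorem exists_hasDerivAt_eval_coords (c : MvPolynomial (Fin n ⊕ Fin n) ℂ) (v : Phase n) :
    ∃ c' : MvPolynomial (Fin n ⊕ Fin n) ℂ, ∀ z : Phase n,
      HasDerivAt (fun t : ℝ => MvPolynomial.eval (coords (z + t • v)) c)
        (MvPolynomial.eval (coords z) c') 0 := by
  induction c using MvPolynomial.induction_on with
  | C a => exact ⟨0, fun z => by simpa using hasDerivAt_const (0 : ℝ) a⟩
  | add p q hp hq =>
    obtain ⟨p', hp⟩ := hp
    obtain ⟨q', hq⟩ := hq
    exact ⟨p' + q', fun z => by simpa using (hp z).fun_add (hq z)⟩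
  | mul_X p i hp =>
    obtain ⟨p', hp⟩ := hp
    refine ⟨p' * MvPolynomial.X i + p * MvPolynomial.C (coords v i), fun z => ?_⟩
    have hi : HasDerivAt (fun t : ℝ => coords (z + t • v) i) (coords v i) 0 := by
      have h : ∀ x y : ℝ, HasDerivAt (fun t : ℝ => ((x + t * y : ℝ) : ℂ)) (y : ℂ) 0 :=
        fun x y => by
          simpa using (((hasDerivAt_id (0 : ℝ)).mul_const y).const_add x).ofReal_comp
      rcases i with i | i
      · exact h (z.1 i) (v.1 i)
      · exact h (z.2 i) (v.2 i)
    simpa using (hp z).fun_mul hi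

/-- The chain rule for `P(q, p, F(q, p))`. -/
theorem exists_hasDerivAt_evalAt (P : Polynomial (MvPolynomial (Fin n ⊕ Fin n) ℂ)) (v : Phase n) :
    ∃ R : Polynomial (MvPolynomial (Fin n ⊕ Fin n) ℂ), ∀ (F : Phase n → ℂ) (z : Phase n) (F' : ℂ),
      HasDerivAt (fun t : ℝ => F (z + t • v)) F' 0 →
      HasDerivAt (fun t : ℝ => evalAt P (F (z + t • v)) (z + t • v))
        (evalAt R (F z) z + evalAt P.derivative (F z) z * F') 0 := by
  induction P using Polynomial.induction_on' with
  | add P Q hP hQ =>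
    obtain ⟨R, hR⟩ := hP
    obtain ⟨S, hS⟩ := hQ
    refine ⟨R + S, fun F z F' h => ?_⟩
    have h1 := (hR F z F' h).fun_add (hS F z F' h)
    simp only [evalAt, Polynomial.map_add, Polynomial.eval_add, Polynomial.derivative_add] at h1 ⊢
    exact h1.congr_deriv (by ring)
  | monomial k c =>
    obtain ⟨c', hc⟩ := exists_hasDerivAt_eval_coords c v
    refine ⟨Polynomial.monomial k c', fun F z F' h => ?_⟩
    have h1 := (hc z).fun_mul (h.fun_pow k)
    simp only [evalAt, Polynomial.map_monomial, Polynomial.eval_monomial,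
      Polynomial.derivative_monomial, map_mul, map_natCast, zero_smul, add_zero] at h1 ⊢
    exact h1.congr_deriv (by ring)

/-- The derivatives of an algebraic function are algebraic on some smaller open set. -/
theorem IsAlgebraicFunctionOn.exists_fderiv {F : Phase n → ℂ} {U : Set (Phase n)} (hU : IsOpen U)
    (hne : U.Nonempty) (hd : DifferentiableOn ℝ F U) (hF : IsAlgebraicFunctionOn F U) :
    ∃ V ⊆ U, IsOpen V ∧ V.Nonempty ∧
      ∀ v, IsAlgebraicFunctionOn (fun z => fderiv ℝ F z v) V := by
  classical
  -- The degree is minimised over all smaller open sets at once. Then `P.derivative`, of lower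
  -- degree, cannot vanish identically on the minimising `V`.
  let good : ℕ → Prop := fun k => ∃ V ⊆ U, IsOpen V ∧ V.Nonempty ∧
    ∃ P : Polynomial (MvPolynomial (Fin n ⊕ Fin n) ℂ), P ≠ 0 ∧ P.natDegree = k ∧
      ∀ z ∈ V, evalAt P (F z) z = 0
  have hex : ∃ k, good k := by
    obtain ⟨P, hP, h0⟩ := hF
    exact ⟨_, U, subset_rfl, hU, hne, P, hP, rfl, h0⟩
  obtain ⟨V, hVU, hV, hVne, P, hP, hdeg, h0⟩ := Nat.find_spec hex
  have hdeg0 : P.natDegree ≠ 0 := by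
    intro h
    rw [Polynomial.eq_C_of_natDegree_eq_zero h] at h0 hP
    refine hP ?_
    rw [eq_zero_of_eval_coords_eq_zero (c := P.coeff 0) hV hVne
      fun z hz => by simpa [evalAt] using h0 z hz, Polynomial.C_0]
  have hlt : P.derivative.natDegree < P.natDegree := Polynomial.natDegree_derivative_lt hdeg0
  have hder : P.derivative ≠ 0 := fun h => hdeg0 (Polynomial.derivative_eq_zero.1 h)
  have hnz : ∃ z ∈ V, evalAt P.derivative (F z) z ≠ 0 := by
    by_contra! h
    exact Nat.find_min hex (hdeg ▸ hlt) ⟨V, hVU, hV, hVne, P.derivative, hder, rfl, h⟩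
  obtain ⟨z₀, hz₀, hne₀⟩ := hnz
  have hcont : ContinuousOn (fun z => evalAt P.derivative (F z) z) V :=
    continuousOn_evalAt (hd.continuousOn.mono hVU) _
  refine ⟨V ∩ (fun z => evalAt P.derivative (F z) z) ⁻¹' {0}ᶜ,
    Set.inter_subset_left.trans hVU, hcont.isOpen_inter_preimage hV isOpen_compl_singleton,
    ⟨z₀, hz₀, hne₀⟩, fun v => ?_⟩
  obtain ⟨R, hR⟩ := exists_hasDerivAt_evalAt P v
  have hF' := hF.mono (V := V ∩ (fun z => evalAt P.derivative (F z) z) ⁻¹' {0}ᶜ)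
    (Set.inter_subset_left.trans hVU)
  -- Implicit differentiation: the derivative of `F` along `v` is -R/P', with both polynomials
  -- evaluated at `F`.
  refine (((isAlgebraicFunctionOn_const (-1) _).mul (isAlgebraicFunctionOn_evalAt hF' R)).mul
    ((isAlgebraicFunctionOn_evalAt hF' P.derivative).inv fun z hz => hz.2)).congr fun z hz => ?_
  have hline : HasDerivAt (fun t : ℝ => z + t • v) v 0 := by
    simpa using ((hasDerivAt_id (0 : ℝ)).smul_const v).const_add z
  have hFz : HasFDerivAt F (fderiv ℝ F z) (z + (0 : ℝ) • v) := by
    simpa using ((hd z (hVU hz.1)).differentiableAt (hU.mem_nhds (hVU hz.1))).hasFDerivAt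
  have h1 := hR F z _ (hFz.comp_hasDerivAt 0 hline)
  have h2 : HasDerivAt (fun t : ℝ => evalAt P (F (z + t • v)) (z + t • v)) 0 0 := by
    refine (hasDerivAt_const (0 : ℝ) (0 : ℂ)).congr_of_eventuallyEq ?_
    have : ∀ᶠ t in 𝓝 (0 : ℝ), z + t • v ∈ V :=
      hline.continuousAt.eventually (by simpa using hV.mem_nhds hz.1)
    filter_upwards [this] with t ht using h0 _ ht
  have h3 := h1.unique h2
  have h4 : evalAt P.derivative (F z) z ≠ 0 := hz.2
  simp only
  field_simp
  linear_combination h3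

end Algebraic

/-! ### Transcendence of irrational powers -/

section RealPowers

open Filter Topology

/-- Finitely many real exponentials with distinct exponents have no linear relation on an
interval. -/
theorem eq_zero_of_sum_exp_eventually_eq_zero {ι : Type*} (s : Finset ι) (c : ι → ℂ) (l : ι → ℝ)
    (hl : Function.Injective l) (t₀ : ℝ)
    (h : ∀ᶠ t in 𝓝 t₀, ∑ i ∈ s, c i * ((Real.exp (l i * t) : ℝ) : ℂ) = 0) :
    ∀ i ∈ s, c i = 0 := by
  -- The exponentials are distinct characters of the additive group ℝ, so Dedekind's theorem makes
  -- them independent.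
  let χ : ι → Multiplicative ℝ →* ℂ := fun i =>
    { toFun := fun t => ((Real.exp (l i * t.toAdd) : ℝ) : ℂ)
      map_one' := by simp
      map_mul' := fun x y => by
        rw [← Complex.ofReal_mul, ← Real.exp_add, toAdd_mul, mul_add] }
  have hχ : Function.Injective χ := by
    intro i j hij
    have h1 := DFunLike.congr_fun hij (Multiplicative.ofAdd (1 : ℝ))
    have h2 : Real.exp (l i * 1) = Real.exp (l j * 1) := Complex.ofReal_injective h1
    exact hl (by simpa using Real.exp_injective h2)
  have hli := (linearIndependent_monoidHom (Multiplicative ℝ) ℂ).comp χ hχ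
  -- Dedekind's theorem needs the relation on the whole group; analyticity extends it from a
  -- neighbourhood of `t₀`.
  have hall : (fun t : ℝ => ∑ i ∈ s, c i * ((Real.exp (l i * t) : ℝ) : ℂ)) = fun _ => 0 := by
    have han : AnalyticOnNhd ℝ
        (fun t : ℝ => ∑ i ∈ s, c i * ((Real.exp (l i * t) : ℝ) : ℂ)) Set.univ := by
      intro t _
      refine Finset.analyticAt_fun_sum s fun i _ => analyticAt_const.mul ?_
      exact (Complex.ofRealCLM.analyticAt _).comp
        (analyticAt_rexp.comp (analyticAt_const.mul analyticAt_id))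
    funext t
    exact han.eqOn_of_preconnected_of_eventuallyEq (fun _ _ => analyticAt_const)
      isPreconnected_univ (Set.mem_univ t₀) h (Set.mem_univ t)
  refine linearIndependent_iff'.1 hli s c ?_
  funext t
  have := congr_fun hall t.toAdd
  simpa [χ] using this

/-- An irrational power is transcendental over the rational functions, on any interval. -/
theorem eq_zero_of_eval_rpow_eventually_eq_zero {a : ℝ} (ha : Irrational a) {β : ℂ} (hβ : β ≠ 0)
    {x₀ : ℝ} (hx₀ : 0 < x₀) (Q : Polynomial (Polynomial ℂ))
    (h : ∀ᶠ x in 𝓝 x₀, (Q.map (Polynomial.evalRingHom ((x : ℝ) : ℂ))).eval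
      (β * ((x ^ a : ℝ) : ℂ)) = 0) : Q = 0 := by
  -- With x = e^t the monomial x^i (x^a)^j becomes exp((i + aj)t), and irrationality of `a` makes
  -- these exponents distinct.
  let l : ℕ × ℕ → ℝ := fun x => x.1 + a * x.2
  have hl : Function.Injective l := by
    rintro ⟨i, j⟩ ⟨i', j'⟩ hij
    simp only [l] at hij
    have hj : j = j' := by
      by_contra hne
      have hne' : ((j : ℝ) - j') ≠ 0 := sub_ne_zero.2 (by exact_mod_cast hne)
      refine ha ⟨((i' : ℚ) - i) / (j - j'), ?_⟩
      push_cast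
      field_simp
      linarith
    subst hj
    simpa using hij
  let N := Q.support.sup fun j => (Q.coeff j).natDegree
  have hexp : Tendsto Real.exp (𝓝 (Real.log x₀)) (𝓝 x₀) := by
    have := Real.continuous_exp.tendsto (Real.log x₀)
    rwa [Real.exp_log hx₀] at this
  have key := eq_zero_of_sum_exp_eventually_eq_zero (Finset.range (N + 1) ×ˢ Q.support)
    (fun x => (Q.coeff x.2).coeff x.1 * β ^ x.2) l hl (Real.log x₀) (by
      filter_upwards [hexp.eventually h] with t ht
      rw [Polynomial.eval_map, Polynomial.eval₂_eq_sum, Polynomial.sum] at ht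
      rw [Finset.sum_product_right, ← ht]
      refine Finset.sum_congr rfl fun j hj => ?_
      rw [Polynomial.coe_evalRingHom, Polynomial.eval_eq_sum_range' (n := N + 1)
        (Nat.lt_succ_of_le (Finset.le_sup (f := fun j => (Q.coeff j).natDegree) hj)),
        Finset.sum_mul]
      refine Finset.sum_congr rfl fun i _ => ?_
      have : Real.exp (l (i, j) * t) = Real.exp t ^ i * (Real.exp t ^ a) ^ j := by
        rw [← Real.exp_mul, ← Real.exp_nat_mul, ← Real.exp_nat_mul, ← Real.exp_add]
        simp only [l]
        ring_nf
      rw [this]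
      push_cast
      ring)
  ext j i
  by_cases hj : j ∈ Q.support
  · by_cases hi : i < N + 1
    · have := key (i, j) (Finset.mem_product.2 ⟨Finset.mem_range.2 hi, hj⟩)
      simpa [hβ] using this
    · refine Polynomial.coeff_eq_zero_of_natDegree_lt ?_
      have := Finset.le_sup (f := fun j => (Q.coeff j).natDegree) hj
      simp only [N] at hi
      omega
  · simp [Polynomial.notMem_support_iff.1 hj]

/-- For irrational `a` the monomial `q₁ ^ a q₂ ^ b` is not algebraic on any open set. -/
theorem not_isAlgebraicFunctionOn_rpow_mul_rpow {a b : ℝ} (ha : Irrational a)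
    {U : Set (Phase 2)} (hU : IsOpen U) (hne : U.Nonempty) (hpos : U ⊆ posPhase) :
    ¬ IsAlgebraicFunctionOn (fun z => ((z.1 0 ^ a * z.1 1 ^ b : ℝ) : ℂ)) U := by
  rintro ⟨P, hP, h0⟩
  obtain ⟨k, hk⟩ : ∃ k, P.coeff k ≠ 0 := by
    by_contra! h
    exact hP (Polynomial.ext fun k => by simpa using h k)
  -- All coordinates except q₁ are frozen at a point where one coefficient of `P` survives, so the
  -- specialised polynomial in q₁ is still non-zero.
  obtain ⟨z, hz, hzk⟩ : ∃ z ∈ U, MvPolynomial.eval (coords z) (P.coeff k) ≠ 0 := by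
    by_contra! h
    exact hk (eq_zero_of_eval_coords_eq_zero hU hne h)
  let γ : ℝ → Phase 2 := fun x => (![x, z.1 1], z.2)
  let σ : MvPolynomial (Fin 2 ⊕ Fin 2) ℂ →+* Polynomial ℂ :=
    MvPolynomial.eval₂Hom Polynomial.C
      (Function.update (fun i => Polynomial.C (coords z i)) (Sum.inl 0) Polynomial.X)
  have hγ : γ (z.1 0) = z := by
    refine Prod.ext (funext fun i => ?_) rfl
    fin_cases i <;> rfl
  have hσ : ∀ x : ℝ, (Polynomial.evalRingHom ((x : ℝ) : ℂ)).comp σ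
      = MvPolynomial.eval (coords (γ x)) := by
    intro x
    refine MvPolynomial.ringHom_ext (fun c => by simp [σ]) fun i => ?_
    rcases i with i | i
    · fin_cases i <;> simp [σ, γ, coords, Function.update]
    · simp [σ, γ, coords]
  have hcont : Continuous γ := by
    refine Continuous.prodMk (continuous_pi fun i => ?_) continuous_const
    fin_cases i
    · exact continuous_id
    · exact continuous_const
  have hQ : P.map σ = 0 := by
    refine eq_zero_of_eval_rpow_eventually_eq_zero ha (β := ((z.1 1 ^ b : ℝ) : ℂ))
      (Complex.ofReal_ne_zero.2 (Real.rpow_pos_of_pos (hpos hz).2 b).ne') (hpos hz).1 _ ?_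
    have : ∀ᶠ x in 𝓝 (z.1 0), γ x ∈ U :=
      hcont.continuousAt.eventually (hU.mem_nhds (by rwa [hγ]))
    filter_upwards [this] with x hx
    have := h0 _ hx
    rw [Polynomial.map_map, hσ]
    convert this using 2
    · simp [γ, mul_comm]
    · rfl
  have hk0 : σ (P.coeff k) = 0 := by
    rw [← Polynomial.coeff_map, hQ, Polynomial.coeff_zero]
  apply hzk
  have := RingHom.congr_fun (hσ (z.1 0)) (P.coeff k)
  rw [hγ] at this
  rw [← this, RingHom.comp_apply, hk0, map_zero]

end RealPowers

/-! ### Smoothness of principal powers, also along the branch cut -/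

section Powers

open Filter Topology

/-- Off zero, and off the negative real axis unless `f` is real-valued, a principal power of `f` is
locally the exponential of a smooth logarithm. -/
theorem eventually_cpow_eq_exp_log {X : Type*} [TopologicalSpace X] {f : X → ℂ} {x : X}
    (hf : ContinuousAt f x) (h0 : f x ≠ 0)
    (hr : f x ∈ Complex.slitPlane ∨ ∀ᶠ y in 𝓝 x, (f y).im = 0) (c : ℂ) :
    ∃ σ κ : ℂ, σ ≠ 0 ∧ σ * f x ∈ Complex.slitPlane ∧
      ∀ᶠ y in 𝓝 x, f y ^ c = Complex.exp (c * Complex.log (σ * f y)) * κ := by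
  by_cases hs : f x ∈ Complex.slitPlane
  · refine ⟨1, 1, one_ne_zero, by simpa using hs, ?_⟩
    filter_upwards [hf.eventually_ne h0] with y hy
    rw [Complex.cpow_def_of_ne_zero hy, one_mul, mul_one, mul_comm]
  · have hr' := hr.resolve_left hs
    have him := hr'.self_of_nhds
    have hre : (f x).re < 0 := by
      rw [Complex.mem_slitPlane_iff, not_or, not_lt] at hs
      exact lt_of_le_of_ne hs.1 fun h => h0 (Complex.ext h him)
    -- On negative reals the principal power is that of the absolute value times the constant phase
    -- e^{iπc}.
    refine ⟨-1, Complex.exp (Real.pi * Complex.I * c), by simp, ?_, ?_⟩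
    · exact Complex.mem_slitPlane_iff.2 (Or.inl (by simpa using hre))
    · have hlt : ∀ᶠ y in 𝓝 x, (f y).re < 0 :=
        (Complex.continuous_re.continuousAt.comp hf).eventually (gt_mem_nhds hre)
      filter_upwards [hr', hlt] with y hy1 hy2
      have hy : f y = ((f y).re : ℂ) := Complex.ext rfl (by simpa using hy1)
      have hne : -((f y).re : ℂ) ≠ 0 := by
        simpa using hy2.ne
      rw [hy, Complex.ofReal_cpow_of_nonpos hy2.le, Complex.cpow_def_of_ne_zero hne,
        neg_one_mul, mul_comm c]

theorem ContDiffAt.cpow_const_of_real {E : Type*} [NormedAddCommGroup E] [NormedSpace ℝ E]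
    {f : E → ℂ} {x : E} (hf : ContDiffAt ℝ ∞ f x) (h0 : f x ≠ 0)
    (hr : f x ∈ Complex.slitPlane ∨ ∀ᶠ y in 𝓝 x, (f y).im = 0) (c : ℂ) :
    ContDiffAt ℝ ∞ (fun y => f y ^ c) x := by
  obtain ⟨σ, κ, -, hs, he⟩ := eventually_cpow_eq_exp_log hf.continuousAt h0 hr c
  refine ContDiffAt.congr_of_eventuallyEq ?_ he
  have hlog : ContDiffAt ℝ ∞ (fun y => Complex.log (σ * f y)) x :=
    ((Complex.contDiffAt_log hs).restrict_scalars ℝ).comp (g := Complex.log) x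
      (contDiffAt_const.mul hf)
  exact (ContDiffAt.cexp (contDiffAt_const.mul hlog)).mul contDiffAt_const

theorem HasDerivAt.cpow_const_of_real {f : ℝ → ℂ} {f' : ℂ} {x : ℝ} (hf : HasDerivAt f f' x)
    (h0 : f x ≠ 0) (hr : f x ∈ Complex.slitPlane ∨ ∀ᶠ y in 𝓝 x, (f y).im = 0) (c : ℂ) :
    HasDerivAt (fun y => f y ^ c) (c * f x ^ c * (f' / f x)) x := by
  obtain ⟨σ, κ, hσ, hs, he⟩ := eventually_cpow_eq_exp_log hf.continuousAt h0 hr c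
  have h1 := ((((hf.const_mul σ).clog_real hs).const_mul c).cexp.mul_const κ).congr_of_eventuallyEq
    he
  refine h1.congr_deriv ?_
  rw [he.self_of_nhds]
  field_simp

theorem HasDerivAt.rpow_const_of_pos {f : ℝ → ℝ} {f' x : ℝ} (hf : HasDerivAt f f' x)
    (h0 : 0 < f x) (r : ℝ) :
    HasDerivAt (fun y => f y ^ r) (r * f x ^ r * (f' / f x)) x := by
  refine (hf.rpow_const (Or.inl h0.ne')).congr_deriv ?_
  rw [Real.rpow_sub_one h0.ne']
  field_simp

end Powers

/-! ### Smoothness and directional derivatives of the integrals -/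

section Calculus

open Filter Topology

variable {d ε : ℝ} {z : Phase 2}

theorem isOpen_posPhase : IsOpen posPhase := by
  have h : ∀ i, IsOpen {z : Phase 2 | 0 < z.1 i} := fun i =>
    isOpen_lt continuous_const (by fun_prop)
  exact (h 0).inter (h 1)

theorem fderiv_apply_eq_of_hasDerivAt {n : ℕ} {F : Phase n → ℂ} {z v : Phase n} {F' : ℂ}
    (hF : DifferentiableAt ℝ F z) (h : HasDerivAt (fun t : ℝ => F (z + t • v)) F' 0) :
    fderiv ℝ F z v = F' := by
  have hline : HasDerivAt (fun t : ℝ => z + t • v) v 0 := by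
    simpa using ((hasDerivAt_id (0 : ℝ)).smul_const v).const_add z
  have hFz : HasFDerivAt F (fderiv ℝ F z) (z + (0 : ℝ) • v) := by
    simpa using hF.hasFDerivAt
  exact (hFz.comp_hasDerivAt 0 hline).unique h

theorem contDiff_position {n : ℕ} (i : Fin n) : ContDiff ℝ ∞ (fun z : Phase n => z.1 i) := by
  fun_prop

theorem ContDiffAt.ofReal {n : ℕ} {f : Phase n → ℝ} {z : Phase n} (hf : ContDiffAt ℝ ∞ f z) :
    ContDiffAt ℝ ∞ (fun w => (f w : ℂ)) z :=
  Complex.ofRealCLM.contDiff.contDiffAt.comp z hf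

theorem contDiffAt_rpow_position (i : Fin 2) (h : 0 < z.1 i) (r : ℝ) :
    ContDiffAt ℝ ∞ (fun w : Phase 2 => w.1 i ^ r) z :=
  (contDiff_position i).contDiffAt.rpow_const_of_ne h.ne'

theorem contDiffAt_H1 (hz : z ∈ posPhase) : ContDiffAt ℝ ∞ (H1 d) z := by
  refine ContDiffAt.ofReal (f := fun z : Phase 2 =>
    2 * z.2 0 * z.2 1 + z.1 0 ^ (-d - 2) * z.1 1 ^ d) ?_
  refine ContDiffAt.add (ContDiff.contDiffAt (by fun_prop)) ?_
  exact (contDiffAt_rpow_position 0 hz.1 _).mul (contDiffAt_rpow_position 1 hz.2 _)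

theorem contDiffAt_I2 (hz : z ∈ posPhase) : ContDiffAt ℝ ∞ (I2 d) z := by
  refine ContDiffAt.ofReal (f := fun z : Phase 2 =>
    (z.2 0 * z.1 0 - z.2 1 * z.1 1) ^ 2 - 2 * (z.1 1 ^ (d + 1) / z.1 0 ^ (d + 1))) ?_
  refine ContDiffAt.sub (ContDiff.contDiffAt (by fun_prop)) ?_
  exact contDiffAt_const.mul ((contDiffAt_rpow_position 1 hz.2 _).div
    (contDiffAt_rpow_position 0 hz.1 _) (Real.rpow_pos_of_pos hz.1 _).ne')

theorem I2_im (d : ℝ) (z : Phase 2) : (I2 d z).im = 0 := Complex.ofReal_im _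

theorem sqrtI2_sq (d : ℝ) (z : Phase 2) : sqrtI2 d z ^ 2 = I2 d z := by
  rw [sqrtI2, ← Complex.cpow_nat_mul]
  norm_num

theorem sqrtI2_ne_zero (h : I2 d z ≠ 0) : sqrtI2 d z ≠ 0 := fun h0 => h (by
  rw [← sqrtI2_sq, h0]
  norm_num)

theorem contDiffAt_sqrtI2 (hz : z ∈ posPhase) (h : I2 d z ≠ 0) : ContDiffAt ℝ ∞ (sqrtI2 d) z :=
  (contDiffAt_I2 hz).cpow_const_of_real h (Or.inr (Eventually.of_forall (I2_im d))) _

theorem contDiffAt_powerBase (hz : z ∈ posPhase) (h : I2 d z ≠ 0) :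
    ContDiffAt ℝ ∞ (powerBase d ε) z := by
  refine ContDiffAt.add ?_ (contDiffAt_const.mul (contDiffAt_sqrtI2 hz h))
  exact ContDiffAt.ofReal (f := fun z : Phase 2 => z.2 0 * z.1 0 + z.2 1 * z.1 1)
    (ContDiff.contDiffAt (by fun_prop))

/-- The root of a positive real is real, that of a negative real is purely imaginary. -/
theorem sqrtI2_im_or_re (d : ℝ) (z : Phase 2) :
    (0 < (I2 d z).re → (sqrtI2 d z).im = 0) ∧ ((I2 d z).re < 0 → (sqrtI2 d z).im ≠ 0) := by
  have hsq := sqrtI2_sq d z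
  have hre := congrArg Complex.re hsq
  have him := congrArg Complex.im hsq
  rw [I2_im] at him
  simp only [pow_two, Complex.mul_re, Complex.mul_im] at hre him
  have h : (sqrtI2 d z).re * (sqrtI2 d z).im = 0 := by linarith
  refine ⟨fun hp => ?_, fun hn h0 => ?_⟩
  · rcases mul_eq_zero.1 h with h | h
    · rw [h] at hre
      nlinarith [sq_nonneg (sqrtI2 d z).im]
    · exact h
  · rw [h0] at hre
    nlinarith [sq_nonneg (sqrtI2 d z).re]

/-- As I₂ is real, its root is non-real where I₂ < 0 and stays real near any point where I₂ > 0.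
Hence the base never crosses the cut from one half-plane to the other, and its principal power is
smooth. -/
theorem powerBase_mem_slitPlane_or_real (hε : ε ≠ 0) (hz : z ∈ posPhase) (h : I2 d z ≠ 0) :
    powerBase d ε z ∈ Complex.slitPlane ∨ ∀ᶠ w in 𝓝 z, (powerBase d ε w).im = 0 := by
  have him : ∀ w, (powerBase d ε w).im = ε * (sqrtI2 d w).im := fun w => by simp [powerBase]
  have hre : (I2 d z).re ≠ 0 := fun h0 => h (Complex.ext h0 (I2_im d z))
  rcases lt_or_gt_of_ne hre with hlt | hgt
  · refine Or.inl (Complex.mem_slitPlane_iff.2 (Or.inr ?_))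
    rw [him]
    exact mul_ne_zero hε ((sqrtI2_im_or_re d z).2 hlt)
  · refine Or.inr ?_
    have : ∀ᶠ w in 𝓝 z, 0 < (I2 d w).re :=
      (Complex.continuous_re.continuousAt.comp (contDiffAt_I2 hz).continuousAt).eventually
        (lt_mem_nhds hgt)
    filter_upwards [this] with w hw
    rw [him, (sqrtI2_im_or_re d w).1 hw, mul_zero]

theorem contDiffAt_signedIntegral (hε : ε ≠ 0) (hz : z ∈ signedDomain d ε) :
    ContDiffAt ℝ ∞ (signedIntegral d ε) z := by
  obtain ⟨hp, hI, hB⟩ := hz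
  refine ContDiffAt.mul (ContDiffAt.mul ?_ ?_) ?_
  · exact ContDiffAt.ofReal (contDiffAt_rpow_position 1 hp.2 _)
  · refine ContDiffAt.add ?_ (contDiffAt_const.mul (contDiffAt_sqrtI2 hp hI))
    exact ContDiffAt.ofReal (f := fun z : Phase 2 => z.2 1 * z.1 1 - z.2 0 * z.1 0)
      (ContDiff.contDiffAt (by fun_prop))
  · exact (contDiffAt_powerBase hp hI).cpow_const_of_real hB
      (powerBase_mem_slitPlane_or_real hε hp hI) _

theorem isOpen_signedDomain (d ε : ℝ) : IsOpen (signedDomain d ε) := by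
  have h1 : ContinuousOn (I2 d) posPhase := fun z hz =>
    (contDiffAt_I2 hz).continuousAt.continuousWithinAt
  have ho := h1.isOpen_inter_preimage isOpen_posPhase isOpen_compl_singleton (t := {0}ᶜ)
  have h2 : ContinuousOn (powerBase d ε) (posPhase ∩ I2 d ⁻¹' {0}ᶜ) := fun z hz =>
    (contDiffAt_powerBase hz.1 hz.2).continuousAt.continuousWithinAt
  convert h2.isOpen_inter_preimage ho isOpen_compl_singleton (t := {0}ᶜ) using 1
  ext z
  simp only [signedDomain, Set.mem_ofPred_eq, Set.mem_inter_iff, Set.mem_preimage, Set.mem_compl_iff,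
    Set.mem_singleton_iff, and_assoc, ne_eq]

/-- The term `q₁^{-d-2} q₂^d` of the Hamiltonian. -/
def potential (d : ℝ) (z : Phase 2) : ℝ := z.1 0 ^ (-d - 2) * z.1 1 ^ d

theorem potential_pos (hz : z ∈ posPhase) : 0 < potential d z :=
  mul_pos (Real.rpow_pos_of_pos hz.1 _) (Real.rpow_pos_of_pos hz.2 _)

theorem H1_eq (d : ℝ) (z : Phase 2) :
    H1 d z = ((2 * z.2 0 * z.2 1 + potential d z : ℝ) : ℂ) := rfl

/-- With this, `potential` is the only real power left in H₁ and I₂, and later identities become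
polynomial. -/
theorem rpow_div_rpow_eq (hz : z ∈ posPhase) :
    z.1 1 ^ (d + 1) / z.1 0 ^ (d + 1) = z.1 0 * z.1 1 * potential d z := by
  obtain ⟨h0, h1⟩ := hz
  rw [potential, Real.rpow_add_one h1.ne', div_eq_mul_inv, ← Real.rpow_neg h0.le,
    show -(d + 1) = -d - 2 + 1 by ring, Real.rpow_add_one h0.ne']
  ring

theorem I2_eq (hz : z ∈ posPhase) :
    I2 d z = (((z.2 0 * z.1 0 - z.2 1 * z.1 1) ^ 2
      - 2 * (z.1 0 * z.1 1 * potential d z) : ℝ) : ℂ) := by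
  rw [I2, rpow_div_rpow_eq hz]

theorem hasDerivAt_position {n : ℕ} (z v : Phase n) (i : Fin n) :
    HasDerivAt (fun t : ℝ => (z + t • v).1 i) (v.1 i) 0 := by
  simpa using ((hasDerivAt_id (0 : ℝ)).mul_const (v.1 i)).const_add (z.1 i)

theorem hasDerivAt_momentum {n : ℕ} (z v : Phase n) (i : Fin n) :
    HasDerivAt (fun t : ℝ => (z + t • v).2 i) (v.2 i) 0 := by
  simpa using ((hasDerivAt_id (0 : ℝ)).mul_const (v.2 i)).const_add (z.2 i)

theorem hasDerivAt_rpow_position (v : Phase 2) (i : Fin 2) (h : 0 < z.1 i) (r : ℝ) :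
    HasDerivAt (fun t : ℝ => (z + t • v).1 i ^ r) (r * z.1 i ^ r * (v.1 i / z.1 i)) 0 := by
  simpa using (hasDerivAt_position z v i).rpow_const_of_pos (by simpa using h) r

theorem hasDerivAt_H1 (hz : z ∈ posPhase) (v : Phase 2) :
    HasDerivAt (fun t : ℝ => H1 d (z + t • v))
      ((2 * (v.2 0 * z.2 1 + z.2 0 * v.2 1)
        + potential d z * ((-d - 2) * (v.1 0 / z.1 0) + d * (v.1 1 / z.1 1)) : ℝ) : ℂ) 0 := by
  have h := ((((hasDerivAt_momentum z v 0).const_mul 2).fun_mul (hasDerivAt_momentum z v 1)).fun_add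
    ((hasDerivAt_rpow_position v 0 hz.1 (-d - 2)).fun_mul
      (hasDerivAt_rpow_position v 1 hz.2 d))).ofReal_comp
  refine h.congr_deriv (congrArg Complex.ofReal ?_)
  simp only [zero_smul, add_zero, potential]
  ring

theorem fderiv_H1 (hz : z ∈ posPhase) (v : Phase 2) :
    fderiv ℝ (H1 d) z v = ((2 * (v.2 0 * z.2 1 + z.2 0 * v.2 1)
        + potential d z * ((-d - 2) * (v.1 0 / z.1 0) + d * (v.1 1 / z.1 1)) : ℝ) : ℂ) :=
  fderiv_apply_eq_of_hasDerivAt ((contDiffAt_H1 hz).differentiableAt (by simp))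
    (hasDerivAt_H1 hz v)

/-- The directional derivative of `I₂`. -/
def I2Deriv (d : ℝ) (z v : Phase 2) : ℝ :=
  2 * (z.2 0 * z.1 0 - z.2 1 * z.1 1)
      * (v.2 0 * z.1 0 + z.2 0 * v.1 0 - (v.2 1 * z.1 1 + z.2 1 * v.1 1))
    - 2 * (d + 1) * (z.1 0 * z.1 1 * potential d z) * (v.1 1 / z.1 1 - v.1 0 / z.1 0)

theorem hasDerivAt_I2 (hz : z ∈ posPhase) (v : Phase 2) :
    HasDerivAt (fun t : ℝ => I2 d (z + t • v)) (I2Deriv d z v : ℂ) 0 := by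
  have hb := ((hasDerivAt_momentum z v 0).fun_mul (hasDerivAt_position z v 0)).fun_sub
    ((hasDerivAt_momentum z v 1).fun_mul (hasDerivAt_position z v 1))
  have h0 : (z + (0 : ℝ) • v).1 0 ^ (d + 1) ≠ 0 := by
    simpa using (Real.rpow_pos_of_pos hz.1 (d + 1)).ne'
  have h := ((hb.fun_pow 2).fun_sub (((hasDerivAt_rpow_position v 1 hz.2 (d + 1)).fun_div
    (hasDerivAt_rpow_position v 0 hz.1 (d + 1)) h0).const_mul 2)).ofReal_comp
  refine h.congr_deriv (congrArg Complex.ofReal ?_)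
  simp only [zero_smul, add_zero] at h0 ⊢
  rw [I2Deriv, ← rpow_div_rpow_eq hz]
  field_simp
  push_cast
  ring

theorem fderiv_I2 (hz : z ∈ posPhase) (v : Phase 2) :
    fderiv ℝ (I2 d) z v = (I2Deriv d z v : ℂ) :=
  fderiv_apply_eq_of_hasDerivAt ((contDiffAt_I2 hz).differentiableAt (by simp))
    (hasDerivAt_I2 hz v)

theorem hasDerivAt_sqrtI2 (hz : z ∈ posPhase) (hI : I2 d z ≠ 0) (v : Phase 2) :
    HasDerivAt (fun t : ℝ => sqrtI2 d (z + t • v)) (I2Deriv d z v / (2 * sqrtI2 d z)) 0 := by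
  have h := (hasDerivAt_I2 hz v).cpow_const_of_real (by simpa using hI)
    (Or.inr (Eventually.of_forall fun t => I2_im d _)) (1 / 2)
  refine h.congr_deriv ?_
  have hs := sqrtI2_ne_zero hI
  simp only [zero_smul, add_zero]
  change 1 / 2 * sqrtI2 d z * _ = _
  rw [← sqrtI2_sq]
  field_simp

/-- The factor `p₂ q₂ - p₁ q₁ + ε √I₂` vanishes nowhere. -/
theorem linearFactor_ne_zero (hε : ε ^ 2 = 1) (hz : z ∈ posPhase) :
    ((z.2 1 * z.1 1 - z.2 0 * z.1 0 : ℝ) : ℂ) + (ε : ℂ) * sqrtI2 d z ≠ 0 := by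
  intro h
  have h1 : (((z.2 1 * z.1 1 - z.2 0 * z.1 0 : ℝ) : ℂ) + (ε : ℂ) * sqrtI2 d z)
      * (((z.2 1 * z.1 1 - z.2 0 * z.1 0 : ℝ) : ℂ) - (ε : ℂ) * sqrtI2 d z)
      = ((2 * (z.1 0 * z.1 1 * potential d z) : ℝ) : ℂ) := by
    have hε' : (ε : ℂ) ^ 2 = 1 := by exact_mod_cast hε
    have hI := sqrtI2_sq d z
    rw [I2_eq hz] at hI
    push_cast at hI ⊢
    linear_combination (-sqrtI2 d z ^ 2) * hε' - hI
  rw [h, zero_mul] at h1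
  have h2 := mul_pos (mul_pos hz.1 hz.2) (potential_pos (d := d) hz)
  have h3 := Complex.ofReal_eq_zero.1 h1.symm
  linarith

/-- The difference of squares (p₁q₁ + p₂q₂)² - I₂. It shows that the base can vanish only where H₁
does. -/
theorem powerBase_mul_conj (hε : ε ^ 2 = 1) (hz : z ∈ posPhase) :
    powerBase d ε z * (((z.2 0 * z.1 0 + z.2 1 * z.1 1 : ℝ) : ℂ) - (ε : ℂ) * sqrtI2 d z)
      = 2 * z.1 0 * z.1 1 * H1 d z := by
  have hε' : (ε : ℂ) ^ 2 = 1 := by exact_mod_cast hε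
  have hI := sqrtI2_sq d z
  rw [I2_eq hz] at hI
  rw [powerBase, H1_eq]
  push_cast at hI ⊢
  linear_combination (-sqrtI2 d z ^ 2) * hε' - hI

theorem signedIntegral_ne_zero (hε : ε ^ 2 = 1) (hz : z ∈ signedDomain d ε) :
    signedIntegral d ε z ≠ 0 := by
  obtain ⟨hp, hI, hB⟩ := hz
  refine mul_ne_zero (mul_ne_zero ?_ (linearFactor_ne_zero hε hp)) ?_
  · exact Complex.ofReal_ne_zero.2 (Real.rpow_pos_of_pos hp.2 _).ne'
  · simp [Complex.cpow_eq_zero_iff, hB]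

theorem fderiv_signedIntegral (hε : ε ^ 2 = 1) (hz : z ∈ signedDomain d ε) (v : Phase 2) :
    fderiv ℝ (signedIntegral d ε) z v = signedIntegral d ε z *
      (-(d + 1) * (v.1 1 / z.1 1)
        + ((v.2 1 * z.1 1 + z.2 1 * v.1 1 - (v.2 0 * z.1 0 + z.2 0 * v.1 0) : ℝ)
            + ε * (I2Deriv d z v / (2 * sqrtI2 d z)))
          / (((z.2 1 * z.1 1 - z.2 0 * z.1 0 : ℝ) : ℂ) + (ε : ℂ) * sqrtI2 d z)
        + (d + 1) * ((v.2 0 * z.1 0 + z.2 0 * v.1 0 + (v.2 1 * z.1 1 + z.2 1 * v.1 1) : ℝ)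
            + ε * (I2Deriv d z v / (2 * sqrtI2 d z))) / powerBase d ε z) := by
  have hε0 : ε ≠ 0 := by
    rintro rfl
    norm_num at hε
  obtain ⟨hp, hI, hB⟩ := hz
  refine fderiv_apply_eq_of_hasDerivAt
    ((contDiffAt_signedIntegral hε0 ⟨hp, hI, hB⟩).differentiableAt (by simp)) ?_
  have hS := (hasDerivAt_sqrtI2 hp hI v).const_mul (ε : ℂ)
  have h0 := (hasDerivAt_momentum z v 0).fun_mul (hasDerivAt_position z v 0)
  have h1 := (hasDerivAt_momentum z v 1).fun_mul (hasDerivAt_position z v 1)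
  have hb := (h1.fun_sub h0).ofReal_comp.fun_add hS
  have ha := (h0.fun_add h1).ofReal_comp.fun_add hS
  have hline : ContinuousAt (fun t : ℝ => z + t • v) 0 := by fun_prop
  have hreal := (powerBase_mem_slitPlane_or_real (d := d) hε0 hp hI).imp
    (fun h => show powerBase d ε (z + (0 : ℝ) • v) ∈ Complex.slitPlane by simpa using h)
    (fun h => hline.eventually (p := fun w => (powerBase d ε w).im = 0) (by simpa using h))
  have hpow := ha.cpow_const_of_real
    (show powerBase d ε (z + (0 : ℝ) • v) ≠ 0 by simpa using hB) hreal ((d + 1 : ℝ) : ℂ)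
  have h := (((hasDerivAt_rpow_position v 1 hp.2 (-(d + 1))).ofReal_comp.fun_mul hb).fun_mul hpow)
  refine h.congr_deriv ?_
  have hC := linearFactor_ne_zero (d := d) hε hp
  have hq : (z.1 1 : ℂ) ≠ 0 := Complex.ofReal_ne_zero.2 hp.2.ne'
  simp only [zero_smul, add_zero]
  rw [show ((z.2 0 * z.1 0 + z.2 1 * z.1 1 : ℝ) : ℂ) + (ε : ℂ) * sqrtI2 d z = powerBase d ε z
    from rfl, signedIntegral]
  generalize ((z.2 1 * z.1 1 - z.2 0 * z.1 0 : ℝ) : ℂ) + (ε : ℂ) * sqrtI2 d z = C at hC ⊢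
  generalize (ε : ℂ) * (I2Deriv d z v / (2 * sqrtI2 d z)) = S
  generalize powerBase d ε z ^ ((d + 1 : ℝ) : ℂ) = Y
  generalize powerBase d ε z = B at hB ⊢
  push_cast
  field_simp

end Calculus

/-! ### Density, first integrals and functional independence -/

section Integrals

open Filter Topology

variable {d ε : ℝ} {z : Phase 2}

theorem eventually_quadratic_ne_zero {a b c : ℝ} (h : a ≠ 0 ∨ b ≠ 0) :
    ∀ᶠ t in 𝓝[≠] (0 : ℝ), a * t ^ 2 + b * t + c ≠ 0 := by
  let p : Polynomial ℝ := Polynomial.C a * Polynomial.X ^ 2 + Polynomial.C b * Polynomial.X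
    + Polynomial.C c
  have hp : p ≠ 0 := by
    intro h0
    have h2 : p.coeff 2 = a := by simp [p]
    have h1 : p.coeff 1 = b := by simp [p, Polynomial.coeff_X_pow, Polynomial.coeff_C]
    rw [h0, Polynomial.coeff_zero] at h1 h2
    exact h.elim (fun h => h h2.symm) (fun h => h h1.symm)
  have hfin : (p.rootSet ℝ \ {0}).Finite := (Polynomial.rootSet_finite p ℝ).sdiff
  have hev : ∀ᶠ t in 𝓝 (0 : ℝ), t ∉ p.rootSet ℝ \ {0} :=
    hfin.isClosed.isOpen_compl.mem_nhds fun h => h.2 rfl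
  filter_upwards [eventually_nhdsWithin_of_eventually_nhds hev, self_mem_nhdsWithin] with t ht ht0 h
  refine ht ⟨?_, ht0⟩
  rw [Polynomial.mem_rootSet]
  exact ⟨hp, by simpa [p] using h⟩

/-- The points at which none of `p₁`, `p₂`, `p₂ q₂ - p₁ q₁`, `H₁`, `I₂` vanishes. -/
def genericPhase (d : ℝ) : Set (Phase 2) :=
  {z | z ∈ posPhase ∧ z.2 0 ≠ 0 ∧ z.2 1 ≠ 0 ∧ z.2 1 * z.1 1 - z.2 0 * z.1 0 ≠ 0 ∧
    H1 d z ≠ 0 ∧ I2 d z ≠ 0}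

theorem posPhase_subset_closure_genericPhase (d : ℝ) :
    posPhase ⊆ closure (genericPhase d) := by
  intro z hz
  obtain ⟨hz0, hz1⟩ := hz
  -- Along `v` the positions stay fixed while p₁q₁ and p₂q₂ grow at the different rates 2 and 1.
  -- Each quantity to be kept non-zero is then a non-constant polynomial in t of degree at most two.
  let v : Phase 2 := (0, ![2 / z.1 0, 1 / z.1 1])
  have hq : ∀ t : ℝ, (z + t • v).1 = z.1 := fun t => by simp [v]
  have hp0 : ∀ t : ℝ, (z + t • v).2 0 = z.2 0 + t * (2 / z.1 0) := fun t => by simp [v]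
  have hp1 : ∀ t : ℝ, (z + t • v).2 1 = z.2 1 + t * (1 / z.1 1) := fun t => by simp [v]
  have hlim : Tendsto (fun t : ℝ => z + t • v) (𝓝[≠] 0) (𝓝 z) := by
    have : ContinuousAt (fun t : ℝ => z + t • v) 0 := by fun_prop
    simpa [ContinuousAt] using this.mono_left nhdsWithin_le_nhds
  refine mem_closure_of_tendsto hlim ?_
  have ha : 2 / z.1 0 ≠ 0 := by positivity
  have hb : 1 / z.1 1 ≠ 0 := by positivity
  filter_upwards [eventually_quadratic_ne_zero (a := 0) (c := z.2 0) (Or.inr ha),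
    eventually_quadratic_ne_zero (a := 0) (c := z.2 1) (Or.inr hb),
    eventually_quadratic_ne_zero (a := 0) (b := -1) (c := z.2 1 * z.1 1 - z.2 0 * z.1 0)
      (Or.inr (by norm_num)),
    eventually_quadratic_ne_zero (b := 2 * (z.2 0 * (1 / z.1 1) + z.2 1 * (2 / z.1 0)))
      (c := 2 * z.2 0 * z.2 1 + potential d z)
      (Or.inl (mul_ne_zero (mul_ne_zero two_ne_zero ha) hb)),
    eventually_quadratic_ne_zero (b := 2 * (z.2 0 * z.1 0 - z.2 1 * z.1 1))
      (c := (z.2 0 * z.1 0 - z.2 1 * z.1 1) ^ 2 - 2 * (z.1 1 ^ (d + 1) / z.1 0 ^ (d + 1)))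
      (Or.inl one_ne_zero)] with t h1 h2 h3 h4 h5
  refine ⟨⟨by rwa [hq], by rwa [hq]⟩, ?_, ?_, ?_, ?_, ?_⟩
  · rw [hp0]
    convert h1 using 1
    ring
  · rw [hp1]
    convert h2 using 1
    ring
  · rw [hp0, hp1, hq]
    convert h3 using 1
    field_simp
    ring
  · rw [H1, hp0, hp1, hq, Complex.ofReal_ne_zero]
    convert h4 using 1
    rw [potential]
    ring
  · rw [I2, hp0, hp1, hq, Complex.ofReal_ne_zero]
    convert h5 using 1
    field_simp
    ring

theorem genericPhase_subset_signedDomain (hε : ε ^ 2 = 1) :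
    genericPhase d ⊆ signedDomain d ε := by
  rintro z ⟨hz, -, -, -, hH, hI⟩
  refine ⟨hz, hI, fun h => ?_⟩
  have h1 := powerBase_mul_conj (d := d) hε hz
  rw [h, zero_mul] at h1
  have h0 : (z.1 0 : ℂ) ≠ 0 := Complex.ofReal_ne_zero.2 hz.1.ne'
  have h2 : (z.1 1 : ℂ) ≠ 0 := Complex.ofReal_ne_zero.2 hz.2.ne'
  exact mul_ne_zero (mul_ne_zero (mul_ne_zero two_ne_zero h0) h2) hH h1.symm

theorem fderiv_apply_eq_partials (F : Phase 2 → ℂ) (z v : Phase 2) :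
    fderiv ℝ F z v = v.1 0 * dq 0 F z + v.1 1 * dq 1 F z
      + (v.2 0 * dp 0 F z + v.2 1 * dp 1 F z) := by
  have hv : v = v.1 0 • ((Pi.single 0 1, 0) : Phase 2) + v.1 1 • ((Pi.single 1 1, 0) : Phase 2)
      + (v.2 0 • ((0, Pi.single 0 1) : Phase 2) + v.2 1 • ((0, Pi.single 1 1) : Phase 2)) := by
    refine Prod.ext (funext fun i => ?_) (funext fun i => ?_) <;> fin_cases i <;> simp
  conv_lhs => rw [hv]
  simp only [map_add, map_smul, Complex.real_smul, dq, dp]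

/-- The Hamiltonian vector field of `H₁`. -/
def hamiltonianField (d : ℝ) (z : Phase 2) : Phase 2 :=
  (![2 * z.2 1, 2 * z.2 0],
    ![(d + 2) * potential d z / z.1 0, -(d * potential d z / z.1 1)])

theorem poissonBracket_H1 (F : Phase 2 → ℂ) (hz : z ∈ posPhase) :
    poissonBracket F (H1 d) z = fderiv ℝ F z (hamiltonianField d z) := by
  rw [fderiv_apply_eq_partials, poissonBracket, Fin.sum_univ_two]
  have h0 : dp 0 (H1 d) z = ((2 * z.2 1 : ℝ) : ℂ) := by
    rw [dp, fderiv_H1 hz]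
    simp
  have h1 : dp 1 (H1 d) z = ((2 * z.2 0 : ℝ) : ℂ) := by
    rw [dp, fderiv_H1 hz]
    simp
  have h2 : dq 0 (H1 d) z = ((-((d + 2) * potential d z / z.1 0) : ℝ) : ℂ) := by
    rw [dq, fderiv_H1 hz]
    congr 1
    simp
    ring
  have h3 : dq 1 (H1 d) z = ((d * potential d z / z.1 1 : ℝ) : ℂ) := by
    rw [dq, fderiv_H1 hz]
    congr 1
    simp
    ring
  rw [h0, h1, h2, h3]
  simp only [hamiltonianField, Matrix.cons_val_zero, Matrix.cons_val_one]
  push_cast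
  ring

theorem I2Deriv_hamiltonianField (hz : z ∈ posPhase) :
    I2Deriv d z (hamiltonianField d z) = 0 := by
  have h0 := hz.1.ne'
  have h1 := hz.2.ne'
  simp only [I2Deriv, hamiltonianField, Matrix.cons_val_zero, Matrix.cons_val_one]
  field_simp
  ring

theorem poissonBracket_I2_H1 (hz : z ∈ posPhase) : poissonBracket (I2 d) (H1 d) z = 0 := by
  rw [poissonBracket_H1 _ hz, fderiv_I2 hz, I2Deriv_hamiltonianField hz, Complex.ofReal_zero]

theorem poissonBracket_self {n : ℕ} (F : Phase n → ℂ) (z : Phase n) :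
    poissonBracket F F z = 0 :=
  Finset.sum_eq_zero fun i _ => by ring

theorem poissonBracket_antisymm {n : ℕ} (F G : Phase n → ℂ) (z : Phase n) :
    poissonBracket F G z = -poissonBracket G F z := by
  rw [poissonBracket, poissonBracket, ← Finset.sum_neg_distrib]
  exact Finset.sum_congr rfl fun i _ => by ring

theorem isFirstIntegralOn_signedIntegral (hε : ε ^ 2 = 1) :
    IsFirstIntegralOn (H1 d) (signedIntegral d ε) (signedDomain d ε) := by
  have hε0 : ε ≠ 0 := by
    rintro rfl
    norm_num at hε
  refine ⟨fun z hz => (contDiffAt_signedIntegral hε0 hz).contDiffWithinAt, fun z hz => ?_⟩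
  have hp := hz.1
  rw [poissonBracket_H1 _ hp, fderiv_signedIntegral hε hz, I2Deriv_hamiltonianField hp]
  refine mul_eq_zero_of_right _ ?_
  have hC := linearFactor_ne_zero (d := d) hε hp
  have hB := hz.2.2
  have hq0 : (z.1 0 : ℂ) ≠ 0 := Complex.ofReal_ne_zero.2 hp.1.ne'
  have hq1 : (z.1 1 : ℂ) ≠ 0 := Complex.ofReal_ne_zero.2 hp.2.ne'
  have hε' : (ε : ℂ) ^ 2 = 1 := by exact_mod_cast hε
  have hI := sqrtI2_sq d z
  rw [I2_eq hp] at hI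
  have h0 := hp.1.ne'
  have h1 := hp.2.ne'
  simp only [hamiltonianField, Matrix.cons_val_zero, Matrix.cons_val_one]
  rw [show -(d * potential d z / z.1 1) * z.1 1 + z.2 1 * (2 * z.2 0)
      - ((d + 2) * potential d z / z.1 0 * z.1 0 + z.2 0 * (2 * z.2 1))
      = -2 * (d + 1) * potential d z by field_simp; ring,
    show (d + 2) * potential d z / z.1 0 * z.1 0 + z.2 0 * (2 * z.2 1)
      + (-(d * potential d z / z.1 1) * z.1 1 + z.2 1 * (2 * z.2 0))
      = 4 * z.2 0 * z.2 1 + 2 * potential d z by field_simp; ring]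
  simp only [Complex.ofReal_zero, zero_div, mul_zero, add_zero]
  rw [powerBase] at hB ⊢
  push_cast at hC hB hI ⊢
  have hS : ((ε : ℂ) * sqrtI2 d z) ^ 2 = (z.2 0 * z.1 0 - z.2 1 * z.1 1) ^ 2
      - 2 * (z.1 0 * z.1 1 * potential d z) := by
    rw [mul_pow, hε', one_mul, hI]
  generalize (ε : ℂ) * sqrtI2 d z = S at hC hB hS ⊢
  generalize (potential d z : ℂ) = V at hS ⊢
  -- Both quotients are rationalised by the conjugates of their denominators: the products are
  -- 2q₁q₂V for the linear factor and 2q₁q₂H₁ for the base, where V is the potential. In the sum the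
  -- root then cancels.
  have e1 : -2 * ((d : ℂ) + 1) * V / (z.2 1 * z.1 1 - z.2 0 * z.1 0 + S)
      = -(d + 1) * (z.2 1 * z.1 1 - z.2 0 * z.1 0 - S) / (z.1 0 * z.1 1) := by
    rw [div_eq_div_iff hC (mul_ne_zero hq0 hq1)]
    linear_combination (-((d : ℂ) + 1)) * hS
  have e2 : ((d : ℂ) + 1) * (4 * z.2 0 * z.2 1 + 2 * V) / (z.2 0 * z.1 0 + z.2 1 * z.1 1 + S)
      = (d + 1) * (z.2 0 * z.1 0 + z.2 1 * z.1 1 - S) / (z.1 0 * z.1 1) := by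
    rw [div_eq_div_iff hB (mul_ne_zero hq0 hq1)]
    linear_combination ((d : ℂ) + 1) * hS
  rw [e1, e2]
  field_simp
  ring

theorem linearIndependent_H1_I2 (hz : z ∈ genericPhase d) :
    LinearIndependent ℂ (fun j => fderiv ℝ (![H1 d, I2 d] j) z) := by
  obtain ⟨hp, -, -, hb, hH, -⟩ := hz
  rw [Fintype.linearIndependent_iff]
  intro g hg
  have hg' : ∀ v, g 0 * fderiv ℝ (H1 d) z v + g 1 * fderiv ℝ (I2 d) z v = 0 := fun v => by
    simpa [Fin.sum_univ_two] using DFunLike.congr_fun hg v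
  have hq0 := hp.1.ne'
  have hq1 := hp.2.ne'
  have h0 : g 0 = 0 := by
    -- The direction of the scaling q → λq, p → p/λ, which fixes I₂ and multiplies H₁ by λ⁻².
    have h := hg' (![z.1 0, z.1 1], ![-z.2 0, -z.2 1])
    have hI : I2Deriv d z (![z.1 0, z.1 1], ![-z.2 0, -z.2 1]) = 0 := by
      simp only [I2Deriv, Matrix.cons_val_zero, Matrix.cons_val_one, div_self hq0, div_self hq1]
      ring
    rw [fderiv_I2 hp, hI, fderiv_H1 hp] at h
    simp only [Matrix.cons_val_zero, Matrix.cons_val_one, div_self hq0, div_self hq1] at h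
    rw [H1_eq] at hH
    have h' : g 0 * (-2 * ((2 * z.2 0 * z.2 1 + potential d z : ℝ) : ℂ)) = 0 := by
      rw [← h]
      push_cast
      ring
    exact (mul_eq_zero.1 h').resolve_right (mul_ne_zero (by norm_num) hH)
  have h1 : g 1 = 0 := by
    have h := hg' (0, ![0, 1 / z.1 1])
    have hI : I2Deriv d z (0, ![0, 1 / z.1 1]) = 2 * (z.2 1 * z.1 1 - z.2 0 * z.1 0) := by
      simp only [I2Deriv, Matrix.cons_val_zero, Matrix.cons_val_one, Pi.zero_apply]
      field_simp
      ring
    rw [h0, fderiv_I2 hp, hI, zero_mul, zero_add] at h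
    exact (mul_eq_zero.1 h).resolve_right
      (Complex.ofReal_ne_zero.2 (mul_ne_zero two_ne_zero hb))
  intro i
  fin_cases i
  exacts [h0, h1]

theorem isLiouvilleIntegrableOn_H1_I2 (d : ℝ) :
    IsLiouvilleIntegrableOn ![H1 d, I2 d] posPhase := by
  refine ⟨fun j z hz => ?_, fun j k z hz => ?_, ?_⟩
  · fin_cases j
    exacts [(contDiffAt_H1 hz).contDiffWithinAt, (contDiffAt_I2 hz).contDiffWithinAt]
  · have h := poissonBracket_I2_H1 (d := d) hz
    fin_cases j <;> fin_cases k
    · exact poissonBracket_self _ _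
    · exact (poissonBracket_antisymm _ _ _).trans (neg_eq_zero.2 h)
    · exact h
    · exact poissonBracket_self _ _
  · exact (posPhase_subset_closure_genericPhase d).trans
      (closure_mono fun z hz => ⟨hz.1, linearIndependent_H1_I2 hz⟩)

/-- A linear relation is tested on three directions. The scaling q → λq, p → p/λ and the equal shift
of p₁q₁ and p₂q₂ both fix I₂; they give two equations for the coefficients of the other two
differentials, with determinant a non-zero multiple of √I₂. Scaling only q₂ and 1/p₂ then isolates
dI₂, by a factor d+1. -/
theorem linearIndependent_H1_I2_signedIntegral (hd : d ≠ -1) (hε : ε ^ 2 = 1)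
    (hz : z ∈ signedDomain d ε) :
    LinearIndependent ℂ (fun j => fderiv ℝ (![H1 d, I2 d, signedIntegral d ε] j) z) := by
  have hε0 : ε ≠ 0 := by
    rintro rfl
    norm_num at hε
  have hp := hz.1
  have hd' : (d : ℂ) + 1 ≠ 0 := by
    rw [← Complex.ofReal_one, ← Complex.ofReal_add, Complex.ofReal_ne_zero]
    exact fun h => hd (by linarith)
  have hq0 := hp.1.ne'
  have hq1 := hp.2.ne'
  have hq0' : (z.1 0 : ℂ) ≠ 0 := Complex.ofReal_ne_zero.2 hq0
  have hq1' : (z.1 1 : ℂ) ≠ 0 := Complex.ofReal_ne_zero.2 hq1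
  have hN := signedIntegral_ne_zero hε hz
  have hB := hz.2.2
  rw [Fintype.linearIndependent_iff]
  intro g hg
  have hg' : ∀ v, g 0 * fderiv ℝ (H1 d) z v + g 1 * fderiv ℝ (I2 d) z v
      + g 2 * fderiv ℝ (signedIntegral d ε) z v = 0 := fun v => by
    simpa [Fin.sum_univ_three] using DFunLike.congr_fun hg v
  have hscale : 2 * g 0 * H1 d z + g 2 * (signedIntegral d ε z * (d + 1)) = 0 := by
    have h := hg' (![z.1 0, z.1 1], ![-z.2 0, -z.2 1])
    have hI : I2Deriv d z (![z.1 0, z.1 1], ![-z.2 0, -z.2 1]) = 0 := by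
      simp only [I2Deriv, Matrix.cons_val_zero, Matrix.cons_val_one, div_self hq0, div_self hq1]
      ring
    rw [fderiv_signedIntegral hε hz, fderiv_I2 hp, hI, fderiv_H1 hp] at h
    simp only [Matrix.cons_val_zero, Matrix.cons_val_one, div_self hq0, div_self hq1,
      div_self hq1'] at h
    rw [H1_eq]
    push_cast at h ⊢
    ring_nf at h ⊢
    linear_combination -h
  have hmom : g 0 * (z.2 0 * z.1 0 + z.2 1 * z.1 1) * powerBase d ε z
      + g 2 * (signedIntegral d ε z * (d + 1)) * (z.1 0 * z.1 1) = 0 := by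
    have h := hg' (0, ![1 / z.1 0, 1 / z.1 1])
    have hI : I2Deriv d z (0, ![1 / z.1 0, 1 / z.1 1]) = 0 := by
      simp only [I2Deriv, Matrix.cons_val_zero, Matrix.cons_val_one, Pi.zero_apply]
      field_simp
      ring
    rw [fderiv_signedIntegral hε hz, fderiv_I2 hp, hI, fderiv_H1 hp] at h
    simp only [Matrix.cons_val_zero, Matrix.cons_val_one, Pi.zero_apply] at h
    push_cast at h
    simp only [zero_div, mul_zero, add_zero, zero_add, one_div, inv_mul_cancel₀ hq0',
      inv_mul_cancel₀ hq1', sub_self] at h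
    field_simp at h
    linear_combination h / 2
  have hprod := powerBase_mul_conj (d := d) hε hp
  have hs : (ε : ℂ) * sqrtI2 d z ≠ 0 :=
    mul_ne_zero (Complex.ofReal_ne_zero.2 hε0) (sqrtI2_ne_zero hz.2.1)
  have h0 : g 0 = 0 := by
    have h : g 0 * (powerBase d ε z * (ε * sqrtI2 d z)) = 0 := by
      push_cast at hprod
      linear_combination hmom - z.1 0 * z.1 1 * hscale - g 0 * hprod
    exact (mul_eq_zero.1 h).resolve_right (mul_ne_zero hB hs)
  have h2 : g 2 = 0 := by
    rw [h0, mul_zero, zero_mul, zero_add] at hscale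
    exact (mul_eq_zero.1 hscale).resolve_right (mul_ne_zero hN hd')
  have h1 : g 1 = 0 := by
    have h := hg' (![0, z.1 1], ![0, -z.2 1])
    have hI : I2Deriv d z (![0, z.1 1], ![0, -z.2 1])
        = -2 * (d + 1) * (z.1 0 * z.1 1 * potential d z) := by
      simp only [I2Deriv, Matrix.cons_val_zero, Matrix.cons_val_one, div_self hq1, zero_div]
      ring
    rw [h0, h2, fderiv_I2 hp, hI, zero_mul, zero_mul, zero_add, add_zero] at h
    refine (mul_eq_zero.1 h).resolve_right (Complex.ofReal_ne_zero.2 ?_)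
    have h3 := (potential_pos (d := d) hp).ne'
    have h4 : d + 1 ≠ 0 := fun h => hd (by linarith)
    exact mul_ne_zero (mul_ne_zero (by norm_num) h4) (mul_ne_zero (mul_ne_zero hq0 hq1) h3)
  intro i
  fin_cases i
  exacts [h0, h1, h2]

theorem functionallyIndependentOn_signedIntegral (hd : d ≠ -1) (hε : ε ^ 2 = 1)
    {U : Set (Phase 2)} (hU : U ⊆ signedDomain d ε) :
    FunctionallyIndependentOn ![H1 d, I2 d, signedIntegral d ε] U :=
  fun _ hz => subset_closure ⟨hz, linearIndependent_H1_I2_signedIntegral hd hε (hU hz)⟩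

end Integrals

/-! ### Algebraic first integrals and the arithmetic of d -/

section AlgebraicIntegrals

open Filter Topology

variable {d ε : ℝ}

/-- The linear vector fields that annihilate a function are closed under commutators. -/
theorem fderiv_apply_commutator_eq_zero {E : Type*} [NormedAddCommGroup E] [NormedSpace ℝ E]
    {F : E → ℂ} {U : Set E} (hU : IsOpen U) (hF : ContDiffOn ℝ ∞ F U) {A B : E →L[ℝ] E}
    (hA : ∀ z ∈ U, fderiv ℝ F z (A z) = 0) (hB : ∀ z ∈ U, fderiv ℝ F z (B z) = 0) :
    ∀ z ∈ U, fderiv ℝ F z ((A.comp B - B.comp A) z) = 0 := by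
  intro z hz
  have hFz : ContDiffAt ℝ ∞ F z := (hF z hz).contDiffAt (hU.mem_nhds hz)
  have hd : HasFDerivAt (fderiv ℝ F) (fderiv ℝ (fderiv ℝ F) z) z :=
    ((hFz.fderiv_right (m := 1) (by norm_cast)).differentiableAt one_ne_zero).hasFDerivAt
  have hsymm : IsSymmSndFDerivAt ℝ F z := hFz.isSymmSndFDerivAt (by
    simpa using (WithTop.coe_le_coe.2 le_top : ((2 : ℕ∞) : WithTop ℕ∞) ≤ ∞))
  have key : ∀ C : E →L[ℝ] E, (∀ w ∈ U, fderiv ℝ F w (C w) = 0) → ∀ v,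
      fderiv ℝ F z (C v) + fderiv ℝ (fderiv ℝ F) z v (C z) = 0 := by
    intro C hC v
    -- Differentiating dF(C) = 0 along v gives dF(Cv) + D²F(v, Cz) = 0. Symmetry of D²F cancels the
    -- second-order terms in the commutator.
    have h1 := hd.clm_apply C.hasFDerivAt
    have h2 : HasFDerivAt (fun w => fderiv ℝ F w (C w)) (0 : E →L[ℝ] ℂ) z := by
      refine (hasFDerivAt_const (0 : ℂ) z).congr_of_eventuallyEq ?_
      filter_upwards [hU.mem_nhds hz] with w hw using hC w hw
    simpa using DFunLike.congr_fun (h1.unique h2) v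
  have h1 := key A hA (B z)
  have h2 := key B hB (A z)
  rw [hsymm.eq (B z) (A z)] at h1
  simp only [_root_.sub_apply, ContinuousLinearMap.comp_apply, map_sub]
  linear_combination h1 - h2

/-- The part `p₂ ∂/∂q₁ + p₁ ∂/∂q₂` of the Hamiltonian vector field. -/
def kineticField : Phase 2 →L[ℝ] Phase 2 :=
  LinearMap.toContinuousLinearMap
    { toFun := fun z => (![z.2 1, z.2 0], 0)
      map_add' := fun x y => by
        refine Prod.ext (funext fun i => ?_) (by simp)
        fin_cases i <;> rfl
      map_smul' := fun c x => by
        refine Prod.ext (funext fun i => ?_) (by simp)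
        fin_cases i <;> rfl }

/-- The direction `(d + 2) q₂ ∂/∂p₁ - d q₁ ∂/∂p₂` of the force. -/
def forceField (d : ℝ) : Phase 2 →L[ℝ] Phase 2 :=
  LinearMap.toContinuousLinearMap
    { toFun := fun z => (0, ![(d + 2) * z.1 1, -(d * z.1 0)])
      map_add' := fun x y => by
        refine Prod.ext (by simp) (funext fun i => ?_)
        fin_cases i <;> simp <;> ring
      map_smul' := fun c x => by
        refine Prod.ext (by simp) (funext fun i => ?_)
        fin_cases i <;> simp <;> ring }

theorem kineticField_apply (z : Phase 2) : kineticField z = (![z.2 1, z.2 0], 0) := rfl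

theorem forceField_apply (d : ℝ) (z : Phase 2) :
    forceField d z = (0, ![(d + 2) * z.1 1, -(d * z.1 0)]) := rfl

/-- This isolates the only non-algebraic ingredient of the equation {F,H₁} = 0, the monomial in
front of the force field. -/
theorem poissonBracket_H1_eq_fields (F : Phase 2 → ℂ) {z : Phase 2} (hz : z ∈ posPhase) :
    poissonBracket F (H1 d) z = 2 * fderiv ℝ F z (kineticField z)
      + ((z.1 0 ^ (-d - 3) * z.1 1 ^ (d - 1) : ℝ) : ℂ) * fderiv ℝ F z (forceField d z) := by
  rw [poissonBracket_H1 F hz]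
  have h : hamiltonianField d z = (2 : ℝ) • kineticField z
      + (z.1 0 ^ (-d - 3) * z.1 1 ^ (d - 1)) • forceField d z := by
    have h0 := hz.1.ne'
    have h1 := hz.2.ne'
    have hV : z.1 0 ^ (-d - 3) * z.1 1 ^ (d - 1) = potential d z / (z.1 0 * z.1 1) := by
      rw [potential, show -d - 3 = -d - 2 - 1 by ring, Real.rpow_sub_one h0,
        Real.rpow_sub_one h1]
      field_simp
    rw [hV, kineticField_apply, forceField_apply, hamiltonianField]
    refine Prod.ext (funext fun i => ?_) (funext fun i => ?_) <;> fin_cases i <;> simp <;> field_simp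
  rw [h, map_add, map_smul, map_smul, Complex.real_smul, Complex.real_smul]
  norm_num

/-- For irrational `d` an algebraic first integral is annihilated separately by the kinetic and by
the force field. -/
theorem fderiv_kineticField_forceField_eq_zero (hd : Irrational d) {F : Phase 2 → ℂ}
    {U : Set (Phase 2)} (hU : IsOpen U) (hpos : U ⊆ posPhase)
    (hF : IsFirstIntegralOn (H1 d) F U) (halg : IsAlgebraicFunctionOn F U) :
    ∀ z ∈ U, fderiv ℝ F z (kineticField z) = 0 ∧ fderiv ℝ F z (forceField d z) = 0 := by
  have hY : ∀ z ∈ U, fderiv ℝ F z (forceField d z) = 0 := by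
    by_contra! hex
    obtain ⟨z₀, hz₀, hne₀⟩ := hex
    have hcont : ContinuousOn (fun z => fderiv ℝ F z (forceField d z)) U :=
      (hF.1.continuousOn_fderiv_of_isOpen hU (by simp)).clm_apply
        (forceField d).continuous.continuousOn
    have hW := hcont.isOpen_inter_preimage hU isOpen_compl_singleton (t := {0}ᶜ)
    obtain ⟨V, hVW, hV, hVne, hder⟩ := (halg.mono Set.inter_subset_left).exists_fderiv hW
      ⟨z₀, hz₀, hne₀⟩ ((hF.1.differentiableOn (by simp)).mono Set.inter_subset_left)
    have hX : IsAlgebraicFunctionOn (fun z => fderiv ℝ F z (kineticField z)) V := by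
      refine (((isAlgebraicFunctionOn_momentum 1 V).mul (hder (Pi.single 0 1, 0))).add
        ((isAlgebraicFunctionOn_momentum 0 V).mul (hder (Pi.single 1 1, 0)))).congr fun z _ => ?_
      simp only
      rw [fderiv_apply_eq_partials, kineticField_apply]
      simp [dq]
    have hYalg : IsAlgebraicFunctionOn (fun z => fderiv ℝ F z (forceField d z)) V := by
      refine (((isAlgebraicFunctionOn_const ((d : ℂ) + 2) V).mul
        ((isAlgebraicFunctionOn_position 1 V).mul (hder (0, Pi.single 0 1)))).add
        ((isAlgebraicFunctionOn_const (-(d : ℂ)) V).mul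
        ((isAlgebraicFunctionOn_position 0 V).mul (hder (0, Pi.single 1 1))))).congr fun z _ => ?_
      simp only
      rw [fderiv_apply_eq_partials, forceField_apply]
      simp [dp]
      ring
    have hd3 : Irrational (-d - 3) := by
      simpa using hd.neg.sub_natCast 3
    -- On `V` the force derivative has no zero, so {F,H₁} = 0 can be solved for the monomial.
    refine not_isAlgebraicFunctionOn_rpow_mul_rpow (b := d - 1) hd3 hV hVne
      (fun z hz => hpos (hVW hz).1) ?_
    refine (((isAlgebraicFunctionOn_const (-2) V).mul hX).mul
      (hYalg.inv fun z hz => (hVW hz).2)).congr fun z hz => ?_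
    have h := hF.2 z (hVW hz).1
    rw [poissonBracket_H1_eq_fields F (hpos (hVW hz).1)] at h
    have hne : fderiv ℝ F z (forceField d z) ≠ 0 := (hVW hz).2
    simp only
    rw [eq_mul_inv_iff_mul_eq₀ hne]
    linear_combination h
  refine fun z hz => ⟨?_, hY z hz⟩
  have h := hF.2 z hz
  rw [poissonBracket_H1_eq_fields F (hpos hz), hY z hz, mul_zero, add_zero] at h
  exact (mul_eq_zero.1 h).resolve_left two_ne_zero

theorem fderiv_eq_zero_of_isAlgebraicFunctionOn (hd : Irrational d) {F : Phase 2 → ℂ}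
    {U : Set (Phase 2)} (hU : IsOpen U) (hpos : U ⊆ posPhase)
    (hF : IsFirstIntegralOn (H1 d) F U) (halg : IsAlgebraicFunctionOn F U) {z : Phase 2}
    (hz : z ∈ U) (h0 : z.2 0 ≠ 0) (h1 : z.2 1 ≠ 0) : fderiv ℝ F z = 0 := by
  have hXY := fderiv_kineticField_forceField_eq_zero hd hU hpos hF halg
  have hX := fun z hz => (hXY z hz).1
  have hY := fun z hz => (hXY z hz).2
  have hZ := fderiv_apply_commutator_eq_zero hU hF.1 hX hY
  have hXZ := fderiv_apply_commutator_eq_zero hU hF.1 hX hZ z hz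
  have hYZ := fderiv_apply_commutator_eq_zero hU hF.1 hY hZ z hz
  have hX := hX z hz
  have hY := hY z hz
  simp only [fderiv_apply_eq_partials, kineticField_apply, forceField_apply,
    _root_.sub_apply, ContinuousLinearMap.comp_apply, Prod.fst_sub, Prod.snd_sub,
    Pi.sub_apply, Matrix.cons_val_zero, Matrix.cons_val_one, Pi.zero_apply] at hX hY hXZ hYZ
  push_cast at hX hY hXZ hYZ
  have hq0 : (z.1 0 : ℂ) ≠ 0 := Complex.ofReal_ne_zero.2 (hpos hz).1.ne'
  have hq1 : (z.1 1 : ℂ) ≠ 0 := Complex.ofReal_ne_zero.2 (hpos hz).2.ne'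
  have hp0 : (z.2 0 : ℂ) ≠ 0 := Complex.ofReal_ne_zero.2 h0
  have hp1 : (z.2 1 : ℂ) ≠ 0 := Complex.ofReal_ne_zero.2 h1
  have hdc : ∀ k : ℕ, (d : ℂ) + k ≠ 0 := fun k => by
    rw [← Complex.ofReal_natCast, ← Complex.ofReal_add, Complex.ofReal_ne_zero]
    exact (hd.add_natCast k).ne_zero
  have hd0 : (d : ℂ) ≠ 0 := by simpa using hdc 0
  have hd1 : (d : ℂ) + 1 ≠ 0 := by simpa using hdc 1
  have hd2 : (d : ℂ) + 2 ≠ 0 := by simpa using hdc 2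
  -- X and [X,[X,Y]] involve only ∂/∂q, while Y and [Y,[X,Y]] involve only ∂/∂p. Each pair is
  -- independent because p₁p₂ ≠ 0, q₁q₂ ≠ 0 and d is none of 0, -1, -2.
  have e2 : dq 1 F z = 0 := by
    have : ((d : ℂ) + 1) * (z.2 0 * dq 1 F z) = 0 := by
      linear_combination (d / 2 : ℂ) * hX - (1 / 4 : ℂ) * hXZ
    simpa [hd1, hp0] using this
  have e1 : dq 0 F z = 0 := by
    simpa [e2, hp1] using hX
  have e3 : dp 0 F z = 0 := by
    have : ((d : ℂ) + 2) * ((d + 1) * (z.1 1 * dp 0 F z)) = 0 := by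
      linear_combination (d / 2 : ℂ) * hY + (1 / 4 : ℂ) * hYZ
    simpa [hd1, hd2, hq1] using this
  have e4 : dp 1 F z = 0 := by
    simpa [e3, hd0, hq0] using hY
  refine ContinuousLinearMap.ext fun v => ?_
  rw [fderiv_apply_eq_partials, e1, e2, e3, e4]
  simp

theorem not_hasAlgebraicAdditionalIntegralOn (hd : Irrational d) {U : Set (Phase 2)}
    (hU : IsOpen U) (hne : U.Nonempty) (hpos : U ⊆ posPhase) :
    ¬ HasAlgebraicAdditionalIntegralOn d U := by
  rintro ⟨F, hF, hind, halg⟩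
  obtain ⟨z₀, hz₀⟩ := hne
  obtain ⟨z₁, -, hz₁, hli⟩ := mem_closure_iff.1 (hind hz₀) U hU hz₀
  have hne : fderiv ℝ F z₁ ≠ 0 := hli.ne_zero 2
  -- The condition dF ≠ 0 is open, so it also holds at some generic point, where p₁p₂ ≠ 0.
  have hW := (hF.1.continuousOn_fderiv_of_isOpen hU (by simp)).isOpen_inter_preimage hU
    isOpen_compl_singleton (t := {0}ᶜ)
  obtain ⟨z, hz, hgen⟩ := mem_closure_iff.1
    (posPhase_subset_closure_genericPhase d (hpos hz₁)) _ hW ⟨hz₁, hne⟩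
  exact hz.2 (fderiv_eq_zero_of_isAlgebraicFunctionOn hd hU hpos hF halg hz.1 hgen.2.1 hgen.2.2.1)

theorem isAlgebraicFunctionOn_rpow_position {r : ℝ} {m : ℤ} {k : ℕ} (hk : 0 < k)
    (hr : r * k = m) (i : Fin 2) {U : Set (Phase 2)} (hpos : ∀ z ∈ U, 0 < z.1 i) :
    IsAlgebraicFunctionOn (fun z => ((z.1 i ^ r : ℝ) : ℂ)) U := by
  refine IsAlgebraicFunctionOn.of_pow hk (((isAlgebraicFunctionOn_position i U).zpow
    (fun z hz => Complex.ofReal_ne_zero.2 (hpos z hz).ne') m).congr fun z hz => ?_)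
  simp only
  rw [← Complex.ofReal_pow, ← Complex.ofReal_zpow, ← Real.rpow_mul_natCast (hpos z hz).le, hr,
    Real.rpow_intCast]

theorem isAlgebraicFunctionOn_signedIntegral {m : ℤ} {k : ℕ} (hk : 0 < k)
    (hd : (d + 1) * k = m) {U : Set (Phase 2)} (hU : U ⊆ signedDomain d ε) :
    IsAlgebraicFunctionOn (signedIntegral d ε) U := by
  have hneg : IsAlgebraicFunctionOn (fun _ : Phase 2 => (-1 : ℂ)) U :=
    isAlgebraicFunctionOn_const _ U
  have hq0 := isAlgebraicFunctionOn_position (n := 2) 0 U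
  have hq1 := isAlgebraicFunctionOn_position (n := 2) 1 U
  have hp0 := isAlgebraicFunctionOn_momentum (n := 2) 0 U
  have hp1 := isAlgebraicFunctionOn_momentum (n := 2) 1 U
  have hr0 := isAlgebraicFunctionOn_rpow_position hk hd 0 (U := U) fun z hz => (hU hz).1.1
  have hr1 := isAlgebraicFunctionOn_rpow_position hk hd 1 (U := U) fun z hz => (hU hz).1.2
  have hb : IsAlgebraicFunctionOn (fun z => ((z.2 1 * z.1 1 - z.2 0 * z.1 0 : ℝ) : ℂ)) U :=
    ((hp1.mul hq1).add (hneg.mul (hp0.mul hq0))).congr fun z _ => by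
      push_cast
      ring
  have ha : IsAlgebraicFunctionOn (fun z => ((z.2 0 * z.1 0 + z.2 1 * z.1 1 : ℝ) : ℂ)) U :=
    ((hp0.mul hq0).add (hp1.mul hq1)).congr fun z _ => by
      push_cast
      ring
  have hI : IsAlgebraicFunctionOn (I2 d) U :=
    ((hb.mul hb).add ((isAlgebraicFunctionOn_const (-2) U).mul (hr1.mul (hr0.inv fun z hz =>
      Complex.ofReal_ne_zero.2 (Real.rpow_pos_of_pos (hU hz).1.1 _).ne')))).congr fun z _ => by
        rw [I2]
        push_cast
        ring
  have hs : IsAlgebraicFunctionOn (fun z => (ε : ℂ) * sqrtI2 d z) U :=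
    (isAlgebraicFunctionOn_const _ U).mul
      (IsAlgebraicFunctionOn.of_pow two_pos (hI.congr fun z _ => sqrtI2_sq d z))
  have hB : IsAlgebraicFunctionOn (powerBase d ε) U := ha.add hs
  have hpow : IsAlgebraicFunctionOn (fun z => powerBase d ε z ^ ((d + 1 : ℝ) : ℂ)) U := by
    refine IsAlgebraicFunctionOn.of_pow hk
      ((hB.zpow (fun z hz => (hU hz).2.2) m).congr fun z _ => ?_)
    simp only
    rw [← Complex.cpow_nat_mul, ← Complex.cpow_intCast]
    congr 1
    rw [mul_comm]
    exact_mod_cast congrArg Complex.ofReal hd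
  have hd' : -(d + 1) * k = ((-m : ℤ) : ℝ) := by
    push_cast
    linarith
  exact ((isAlgebraicFunctionOn_rpow_position hk hd' 1 (U := U) fun z hz => (hU hz).1.2).mul
    (hb.add hs)).mul hpow

theorem isAlgebraicFunctionOn_signedIntegral_of_rat (hd : ∃ r : ℚ, d = r) {U : Set (Phase 2)}
    (hU : U ⊆ signedDomain d ε) : IsAlgebraicFunctionOn (signedIntegral d ε) U := by
  obtain ⟨r, rfl⟩ := hd
  -- Numerator and denominator are those of the exponent d+1, which governs every power in the
  -- formula.
  refine isAlgebraicFunctionOn_signedIntegral (r + 1).pos (m := (r + 1).num) ?_ hU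
  exact_mod_cast Rat.mul_den_eq_num (r + 1)

theorem irrational_of_not_exists (hd : ¬ ∃ r : ℚ, d = r) : Irrational d :=
  fun ⟨r, hr⟩ => hd ⟨r, hr.symm⟩

theorem isAlgebraicFunctionOn_signedIntegral_iff (hε : ε ^ 2 = 1) {U : Set (Phase 2)}
    (hU : IsOpen U) (hne : U.Nonempty) (hsub : U ⊆ signedDomain d ε) :
    IsAlgebraicFunctionOn (signedIntegral d ε) U ↔ ∃ r : ℚ, d = r := by
  refine ⟨fun halg => ?_, fun hd => isAlgebraicFunctionOn_signedIntegral_of_rat hd hsub⟩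
  by_contra hd
  -- The exceptional value -1 is rational, so independence is available here.
  have hd1 : d ≠ -1 := fun h => hd ⟨-1, by simpa using h⟩
  have hF := isFirstIntegralOn_signedIntegral (d := d) hε
  exact not_hasAlgebraicAdditionalIntegralOn (irrational_of_not_exists hd) hU hne
    (fun z hz => (hsub hz).1)
    ⟨_, ⟨hF.1.mono hsub, fun z hz => hF.2 z (hsub hz)⟩,
      functionallyIndependentOn_signedIntegral hd1 hε hsub, halg⟩

theorem isAlgebraicallySuperIntegrable_iff (hd1 : d ≠ -1) :
    IsAlgebraicallySuperIntegrable d ↔ ∃ r : ℚ, d = r := by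
  have h1 : (1 : ℝ) ^ 2 = 1 := one_pow 2
  constructor
  · rintro ⟨U, hU, hpos, hdense, hint⟩
    by_contra hd
    have hmem : ((fun _ => 1, 0) : Phase 2) ∈ posPhase := ⟨one_pos, one_pos⟩
    exact not_hasAlgebraicAdditionalIntegralOn (irrational_of_not_exists hd) hU
      (closure_nonempty_iff.1 ⟨_, hdense hmem⟩) hpos hint
  · intro hd
    exact ⟨signedDomain d 1, isOpen_signedDomain d 1, fun z hz => hz.1,
      (posPhase_subset_closure_genericPhase d).trans
        (closure_mono (genericPhase_subset_signedDomain h1)),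
      _, isFirstIntegralOn_signedIntegral h1,
      functionallyIndependentOn_signedIntegral hd1 h1 subset_rfl,
      isAlgebraicFunctionOn_signedIntegral_of_rat hd subset_rfl⟩

end AlgebraicIntegrals

end

theorem mainTheorem4 (d : ℝ) :
    -- integrability, for every `d`
    IsLiouvilleIntegrableOn ![H1 d, I2 d] posPhase ∧
    -- `H₃` and `H₄` are first integrals on open dense sets, for every `d`
    (IsOpen (domH3 d) ∧ posPhase ⊆ closure (domH3 d) ∧
      IsFirstIntegralOn (H1 d) (H3 d) (domH3 d)) ∧
    (IsOpen (domH4 d) ∧ posPhase ⊆ closure (domH4 d) ∧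
      IsFirstIntegralOn (H1 d) (H4 d) (domH4 d)) ∧
    -- they are algebraic exactly for rational `d`
    (∀ U : Set (Phase 2), IsOpen U → U.Nonempty → U ⊆ domH3 d →
      (IsAlgebraicFunctionOn (H3 d) U ↔ ∃ r : ℚ, d = r)) ∧
    (∀ U : Set (Phase 2), IsOpen U → U.Nonempty → U ⊆ domH4 d →
      (IsAlgebraicFunctionOn (H4 d) U ↔ ∃ r : ℚ, d = r)) ∧
    (d ≠ -1 →
      -- they are additional integrals
      FunctionallyIndependentOn ![H1 d, I2 d, H3 d] (domH3 d) ∧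
      FunctionallyIndependentOn ![H1 d, I2 d, H4 d] (domH4 d) ∧
      -- super-integrability with an algebraic additional integral
      (IsAlgebraicallySuperIntegrable d ↔ ∃ r : ℚ, d = r) ∧
      -- for irrational `d` there is no such integral even locally
      ((¬ ∃ r : ℚ, d = r) → ∀ U : Set (Phase 2), IsOpen U → U.Nonempty → U ⊆ posPhase →
        ¬ HasAlgebraicAdditionalIntegralOn d U)) := by
  have h1 : (1 : ℝ) ^ 2 = 1 := one_pow 2
  have h2 : (-1 : ℝ) ^ 2 = 1 := by norm_num
  have hdense : ∀ {ε : ℝ}, ε ^ 2 = 1 → posPhase ⊆ closure (signedDomain d ε) := fun hε =>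
    (posPhase_subset_closure_genericPhase d).trans
      (closure_mono (genericPhase_subset_signedDomain hε))
  exact ⟨isLiouvilleIntegrableOn_H1_I2 d,
    ⟨isOpen_signedDomain d 1, hdense h1, isFirstIntegralOn_signedIntegral h1⟩,
    ⟨isOpen_signedDomain d (-1), hdense h2, isFirstIntegralOn_signedIntegral h2⟩,
    fun _ hU hne hsub => isAlgebraicFunctionOn_signedIntegral_iff h1 hU hne hsub,
    fun _ hU hne hsub => isAlgebraicFunctionOn_signedIntegral_iff h2 hU hne hsub,
    fun hd1 => ⟨functionallyIndependentOn_signedIntegral hd1 h1 subset_rfl,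
      functionallyIndependentOn_signedIntegral hd1 h2 subset_rfl,
      isAlgebraicallySuperIntegrable_iff hd1,
      fun hd _ hU hne hpos =>
        not_hasAlgebraicAdditionalIntegralOn (irrational_of_not_exists hd) hU hne hpos⟩⟩
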